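/- **Setting.** Let $l_1\in\mathbb R^d$ (signal) and $l_2,\dots,l_{N+1}\in\mathbb R^d$ (noises) be nonzero, pairwise orthogonal vectors with zero sum, let $\gamma_2,\dots,\gamma_{N+1}>0$ and $T>0$. A $d$-level quantum system evolves under the master equation $$\dot\rho=\sum_{j=1}^{N+1}\gamma_j\left(L_j\rho L_j^\dagger-\tfrac12\{L_j^\dagger L_j,\rho\}\right),\qquad L_j=\mathrm{diag}(l_j)$$ (commuting Hermitian jump operators in a common eigenbasis), where $\gamma_1$ is unknown and $\theta=\sqrt{\gamma_1}$ is to be estimated. The quantum Fisher information (QFI) of a family of states is the supremum over all measurements (POVMs) of the classical Fisher information of the outcome. A *sequential strategy* with $M$ rounds prepares a state of the system and a finite-dimensional noiseless ancilla, alternates $M$ times evolution for a time $T/M$ with an arbitrary control channel on system and ancilla, and finally measures. The *optimal QFI* $\mathcal I$ is the limit of the supremum over these strategies of the QFI about $\theta$, taking first $M\to\infty$ and then $\theta\to0^+$ (i.e. $\mathcal I$ is such that for every neighbourhood $U$ of it and all small enough $\theta>0$, the supremum lies in $U$ for all large $M$). *Measure-and-reset* with a pure state $\psi$ of system and ancilla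 repeats $M$ times: prepare $\psi$, evolve for a time $T/M$, measure; its QFI is $M$ times that of one repetition. A probability distribution $p$ on $\{1,\dots,d\}$ is *optimal* if measure-and-reset with every $\psi$ (with any ancilla, or none) whose populations are $\sum_\beta|\psi_{\alpha\beta}|^2=p_\alpha$ attains $\mathcal I$ in the same limit. For $I\subseteq\{1,\dots,d\}$ let $v^{(I)}\in\mathbb R^I$ be the restriction of $v$, let $S_I=\mathrm{span}\{\vec 1^{(I)},l_2^{(I)},\dots,l_{N+1}^{(I)}\}$, where $\vec 1=(1,\dots,1)$, and let $l_{1,\perp}^{(I)}$ be the orthogonal projection of $l_1^{(I)}$ onto $S_I^\perp$. The noises are *regular* if $S_J=\mathbb R^J$ for every $J$ with at most $N+1$ elements. **Claim.** 1. If $d=N+2$, and the noises are regular or $d=3$, then $$\mathcal I=4T\,\frac{\|l_1\|_2^4}{\|l_1\|_1^2},$$ and a distribution $p$ is optimal if and only if $p_\alpha=|l_{1,\alpha}|/\|l_1\|_1$ for all $\alpha$. If $N=0$ and $d=2$, then $\mathcal I=2T\|l_1\|_2^2$. 2. For arbitrary $d$ and $N$, an optimal distribution exists. Let $a=l_1-c_1\vec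 1-\sum_{j\ge2}c_jl_j$, where the real coefficients $c_j$ minimise $\|a\|_\infty$, and let $I=\{\alpha:|a_\alpha|=\|a\|_\infty\}$. Then $\mathcal I=4T\|a\|_\infty^2$, and every optimal distribution is supported in $I$. If moreover $\dim S_I=|I|-1$, then $$\mathcal I=4T\,\frac{\|l_{1,\perp}^{(I)}\|_2^4}{\|l_{1,\perp}^{(I)}\|_1^2},\qquad(*)$$ and $p$ is optimal if and only if $p_\alpha=|(l_{1,\perp}^{(I)})_\alpha|/\|l_{1,\perp}^{(I)}\|_1$ for $\alpha\in I$ and $p_\alpha=0$ otherwise. 3. For arbitrary $d$ and $N$, let $I$ be the support of an optimal distribution, minimal with respect to inclusion among the supports of optimal distributions (in particular, the support of the optimal distribution if that is unique). Then $(*)$ holds for this $I$, and the only optimal distribution with support $I$ is $p_\alpha=|(l_{1,\perp}^{(I)})_\alpha|/\|l_{1,\perp}^{(I)}\|_1$ for $\alpha\in I$, $p_\alpha=0$ otherwise. -/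

import Mathlib

open scoped ENNReal Topology Kronecker ComplexOrder
open Filter

/-! ## Density matrices, channels, measurements -/

/-- A density matrix: positive semidefinite with unit trace. -/
structure DensityMatrix (n : Type) [Fintype n] where
  mat : Matrix n n ℂ
  posSemidef : mat.PosSemidef
  trace_eq_one : mat.trace = 1

/-- A quantum channel (completely positive trace-preserving map), given by Kraus operators. -/
structure QuantumChannel (n : Type) [Fintype n] [DecidableEq n] where
  rank : ℕ
  kraus : Fin rank → Matrix n n ℂ
  trace_preserving : ∑ j, (kraus j).conjTranspose * kraus j = 1

/-- The action `ρ ↦ ∑ⱼ Kⱼ ρ Kⱼ†` of a quantum channel. -/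
def QuantumChannel.apply {n : Type} [Fintype n] [DecidableEq n] (C : QuantumChannel n)
    (ρ : Matrix n n ℂ) : Matrix n n ℂ :=
  ∑ j, C.kraus j * ρ * (C.kraus j).conjTranspose

/-- A positive operator-valued measure with `m` outcomes. -/
structure POVM (n : Type) [Fintype n] [DecidableEq n] (m : ℕ) where
  effect : Fin m → Matrix n n ℂ
  posSemidef : ∀ x, (effect x).PosSemidef
  sum_eq_one : ∑ x, effect x = 1

/-! ## Classical and quantum Fisher information -/

/-- The classical Fisher information at `θ` of a family of distributions on `m` outcomes. Outcomes
of probability zero contribute nothing (real division by zero is zero). -/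
noncomputable def classicalFisher {m : ℕ} (p : ℝ → Fin m → ℝ) (θ : ℝ) : ℝ≥0∞ :=
  ∑ x, ENNReal.ofReal ((deriv (fun θ' => p θ' x) θ) ^ 2 / p θ x)

/-- The quantum Fisher information at `θ` of a family of states: the classical Fisher information
of the outcome distribution `Tr (Eₓ ρ(θ))`, maximised over all measurements. -/
noncomputable def quantumFisher {n : Type} [Fintype n] [DecidableEq n] (ρ : ℝ → Matrix n n ℂ)
    (θ : ℝ) : ℝ≥0∞ :=
  ⨆ (m : ℕ) (E : POVM n m),
    classicalFisher (fun θ' x => (Matrix.trace (E.effect x * ρ θ')).re) θ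

/-! ## The Lindblad master equation -/

/-- The dissipator `L ρ L† - (L†L ρ + ρ L†L) / 2` of a jump operator. -/
noncomputable def dissipator {n : Type} [Fintype n] (L ρ : Matrix n n ℂ) : Matrix n n ℂ :=
  L * ρ * L.conjTranspose
    - (1 / 2 : ℂ) • (L.conjTranspose * L * ρ + ρ * (L.conjTranspose * L))

/-- The Lindbladian with signal jump operator `L₁` of rate `γ₁`, noise jump operators `L k` of rates
`γ k`, and no Hamiltonian. -/
noncomputable def lindbladian {n : Type} [Fintype n] {N : ℕ} (L₁ : Matrix n n ℂ)
    (L : Fin N → Matrix n n ℂ) (γ₁ : ℝ) (γ : Fin N → ℝ) (ρ : Matrix n n ℂ) : Matrix n n ℂ :=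
  (γ₁ : ℂ) • dissipator L₁ ρ + ∑ k, (γ k : ℂ) • dissipator (L k) ρ

/-- The solution `exp (t 𝓛) ρ` at time `t` of the master equation with initial state `ρ`. -/
noncomputable def lindbladEvolve {n : Type} [Fintype n] {N : ℕ} (L₁ : Matrix n n ℂ)
    (L : Fin N → Matrix n n ℂ) (γ₁ : ℝ) (γ : Fin N → ℝ) (t : ℝ) (ρ : Matrix n n ℂ) :
    Matrix n n ℂ :=
  ∑' k : ℕ, ((t ^ k / (k.factorial : ℝ) : ℝ) : ℂ) • (lindbladian L₁ L γ₁ γ)^[k] ρ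

/-- The evolution of a `d`-level system together with a noiseless `a`-level ancilla: every jump
operator `L` acts as `L ⊗ 1`. -/
noncomputable def extendedEvolve {d N : ℕ} (a : ℕ) (L₁ : Matrix (Fin d) (Fin d) ℂ)
    (L : Fin N → Matrix (Fin d) (Fin d) ℂ) (γ₁ : ℝ) (γ : Fin N → ℝ) (t : ℝ)
    (ρ : Matrix (Fin d × Fin a) (Fin d × Fin a) ℂ) :
    Matrix (Fin d × Fin a) (Fin d × Fin a) ℂ :=
  lindbladEvolve (L₁ ⊗ₖ (1 : Matrix (Fin a) (Fin a) ℂ))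
    (fun k => L k ⊗ₖ (1 : Matrix (Fin a) (Fin a) ℂ)) γ₁ γ t ρ

/-! ## Strategies

The parameter to be estimated is `θ = √γ₁`. -/

/-- The state after `M` rounds of a sequential strategy: in round `k` system and ancilla evolve for
a time `t`, and then the control operation `C k` is performed on both. -/
noncomputable def sequentialState {d N : ℕ} (a : ℕ) (L₁ : Matrix (Fin d) (Fin d) ℂ)
    (L : Fin N → Matrix (Fin d) (Fin d) ℂ) (γ₁ : ℝ) (γ : Fin N → ℝ) (t : ℝ)
    (C : ℕ → QuantumChannel (Fin d × Fin a)) (ρ₀ : Matrix (Fin d × Fin a) (Fin d × Fin a) ℂ) :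
    ℕ → Matrix (Fin d × Fin a) (Fin d × Fin a) ℂ
  | 0 => ρ₀
  | k + 1 => (C k).apply
      (extendedEvolve a L₁ L γ₁ γ t (sequentialState a L₁ L γ₁ γ t C ρ₀ k))

/-- The largest quantum Fisher information about `θ = √γ₁` reached in total time `T` by sequential
strategies with `M` rounds of duration `T / M`, over all finite-dimensional noiseless ancillae,
initial states, control operations and final measurements. -/
noncomputable def sequentialQFI {d N : ℕ} (L₁ : Matrix (Fin d) (Fin d) ℂ)
    (L : Fin N → Matrix (Fin d) (Fin d) ℂ) (γ : Fin N → ℝ) (T : ℝ) (M : ℕ) (θ : ℝ) : ℝ≥0∞ :=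
  ⨆ (a : ℕ) (ρ₀ : DensityMatrix (Fin d × Fin a)) (C : ℕ → QuantumChannel (Fin d × Fin a)),
    quantumFisher (fun θ' => sequentialState a L₁ L (θ' ^ 2) γ (T / M) C ρ₀.mat M) θ

/-- The quantum Fisher information about `θ = √γ₁` reached in total time `T` by `M` repetitions of
preparing the pure state `ψ`, evolving for a time `T / M`, and measuring. -/
noncomputable def measureResetQFI {d N a : ℕ} (L₁ : Matrix (Fin d) (Fin d) ℂ)
    (L : Fin N → Matrix (Fin d) (Fin d) ℂ) (γ : Fin N → ℝ) (T : ℝ) (ψ : Fin d × Fin a → ℂ)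
    (M : ℕ) (θ : ℝ) : ℝ≥0∞ :=
  M * quantumFisher
    (fun θ' => extendedEvolve a L₁ L (θ' ^ 2) γ (T / M) (Matrix.vecMulVec ψ (star ψ))) θ

/-- `v` is the limit of `F M θ` for fast control (`M → ∞`) first and vanishing signal (`θ → 0⁺`)
second: for each neighbourhood `U` of `v`, for all small `θ > 0`, `F M θ ∈ U` for all large `M`. -/
def HasFastVanishingLimit (F : ℕ → ℝ → ℝ≥0∞) (v : ℝ≥0∞) : Prop :=
  Tendsto (fun q : ℝ × ℕ => F q.2 q.1) ((𝓝[>] (0 : ℝ)).curry atTop) (𝓝 v)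

/-! ## The commuting Hermitian case

In a common eigenbasis the jump operators are `diag l₁` (signal) and `diag (l k)` (noise). -/

/-- The operator `diag v` of a real vector. -/
def diagOp {d : ℕ} (v : Fin d → ℝ) : Matrix (Fin d) (Fin d) ℂ :=
  Matrix.diagonal fun α => (v α : ℂ)

/-- `v` is the optimal quantum Fisher information about `√γ₁` in the limit of vanishing signal, over
all strategies with fast and precise control in total time `T`. -/
def IsOptimalQFI {d N : ℕ} (l₁ : Fin d → ℝ) (l : Fin N → Fin d → ℝ) (γ : Fin N → ℝ) (T : ℝ)
    (v : ℝ≥0∞) : Prop :=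
  HasFastVanishingLimit (sequentialQFI (diagOp l₁) (fun k => diagOp (l k)) γ T) v

/-- `p` is an optimal distribution: every pure state of system and ancilla (possibly trivial) with
populations `p` in the eigenbasis attains the optimal quantum Fisher information by repeated
measurement and reset. -/
def IsOptimalDistribution {d N : ℕ} (l₁ : Fin d → ℝ) (l : Fin N → Fin d → ℝ) (γ : Fin N → ℝ)
    (T : ℝ) (p : Fin d → ℝ) : Prop :=
  p ∈ stdSimplex ℝ (Fin d) ∧
  ∃ v : ℝ≥0∞, IsOptimalQFI l₁ l γ T v ∧
    ∀ (a : ℕ) (ψ : Fin d × Fin a → ℂ), (∀ α, ∑ β, ‖ψ (α, β)‖ ^ 2 = p α) →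
      HasFastVanishingLimit (measureResetQFI (diagOp l₁) (fun k => diagOp (l k)) γ T ψ) v

/-- The span in `ℝᴵ` of the restrictions to `I` of the all-ones vector and the noise vectors. -/
def noiseSpan {d N : ℕ} (l : Fin N → Fin d → ℝ) (I : Finset (Fin d)) :
    Submodule ℝ (EuclideanSpace ℝ I) :=
  Submodule.span ℝ (insert (WithLp.toLp 2 fun _ => 1)
    (Set.range fun k => WithLp.toLp 2 fun α : I => l k α))

/-- Regularity (generalised non-degeneracy) of `1, l 0, …, l (N - 1)`: for every set `J` of at most
`N + 1` indices, the restrictions to `J` of these `N + 1` vectors span `ℝᴶ`. -/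
def IsRegularNoise {d N : ℕ} (l : Fin N → Fin d → ℝ) : Prop :=
  ∀ J : Finset (Fin d), J.card ≤ N + 1 → noiseSpan l J = ⊤

/-- `a` is the residual of a solution of the minimisation of `‖l₁ - c₀ 1 - ∑ₖ cₖ lₖ‖_∞` over real
coefficients (the norm of `Fin d → ℝ` is the supremum norm). -/
def IsMinimalResidual {d N : ℕ} (l₁ : Fin d → ℝ) (l : Fin N → Fin d → ℝ) (a : Fin d → ℝ) : Prop :=
  (∃ (c₀ : ℝ) (c : Fin N → ℝ), a = l₁ - c₀ • 1 - ∑ k, c k • l k) ∧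
  ∀ (c₀ : ℝ) (c : Fin N → ℝ), ‖a‖ ≤ ‖l₁ - c₀ • 1 - ∑ k, c k • l k‖

/-- The indices at which `|a α|` is maximal. -/
noncomputable def maxIndices {d : ℕ} (a : Fin d → ℝ) : Finset (Fin d) :=
  Finset.univ.filter fun α => |a α| = ‖a‖

/-- The projection of the restriction of `l₁` to `I` onto the orthogonal complement of
`noiseSpan l I`. -/
noncomputable def perpPart {d N : ℕ} (l₁ : Fin d → ℝ) (l : Fin N → Fin d → ℝ)
    (I : Finset (Fin d)) : EuclideanSpace ℝ I :=
  (noiseSpan l I)ᗮ.starProjection (WithLp.toLp 2 fun α : I => l₁ α)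

/-- The number `4 T ‖w‖₂⁴ / ‖w‖₁²`. -/
noncomputable def normRatioQFI {ι : Type} [Fintype ι] (T : ℝ) (w : ι → ℝ) : ℝ≥0∞ :=
  ENNReal.ofReal (4 * T * (∑ α, w α ^ 2) ^ 2 / (∑ α, |w α|) ^ 2)

/-- The distribution on `Fin d` that is proportional to `|w|` on `I` and zero elsewhere. -/
noncomputable def absDistribution {d : ℕ} (I : Finset (Fin d)) (w : I → ℝ) (α : Fin d) : ℝ :=
  if h : α ∈ I then |w ⟨α, h⟩| / ∑ β, |w β| else 0

/-- `I` is the set of indices with `p α ≠ 0` for some optimal distribution `p`. -/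
def IsOptimalSupport {d N : ℕ} (l₁ : Fin d → ℝ) (l : Fin N → Fin d → ℝ) (γ : Fin N → ℝ) (T : ℝ)
    (I : Finset (Fin d)) : Prop :=
  ∃ p, IsOptimalDistribution l₁ l γ T p ∧ ∀ α, α ∈ I ↔ p α ≠ 0

/-! Diagonal jump operators make the evolution multiply the coherence of levels `i`, `j` by `exp (-t
Γᵢⱼ)`, where `Γᵢⱼ` is half the squared distance of the points `yᵢ = (θ l₁ᵢ, √γₖ lₖᵢ)` in a Euclidean
space. The theorem expresses a saddle point: `‖a‖²` is the least value of the largest squared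
residual, and also the greatest value, over distributions `p`, of the least `p`-average of squared
residuals.

Upper bound. Only distances matter, so the points for `θ + h` may be moved by an isometry before
they are compared with those for `θ`. Rotation with velocity `c` and translation with velocity `c₀`
leave, to leading order in `h`, a squared displacement of `h²` times the squared residual, plus a
term that vanishes with `θ`. The Gaussian kernel on the union of both configurations is positive
semidefinite. Schur multiplication by it evolves a positive semidefinite block matrix whose diagonal
blocks are the two states. The trace of the off-diagonal block bounds the fidelity from below;
control preserves it, and each round costs at most half the largest squared displacement times `T /
M`. Through the Hellinger distance this bounds the Fisher information by `4T` times the largest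
squared residual (`sequentialQFI_le`), and for measure-and-reset by `4T` times the `p`-average
(`quantumFisher_extendedEvolve_le`).

Lower bound. If `p r` is orthogonal to `1` and to the noises, then `r ψ` is orthogonal to `ψ` and is
populated at first order in time by the signal alone, so projecting on it yields `4T ∑ p r²` when
this sum equals `∑ p r l₁`. A flag that remembers the first jump makes this a sequential strategy.

Duality. Separating a point from a compact convex set yields a `p` on the maximal indices of `|a|`
for which `r = a` is admissible (`exists_isBalanced`); the bounds then meet at `4T ‖a‖²`.
Conversely, the averaged upper bound forces every optimal `p` to satisfy these conditions
(`isOptimalDistribution_iff`). When the noise span has codimension one on `I`, the vector `p a` is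
proportional to the perpendicular part of `l₁`, and since `|a|` is constant on the support this
determines `p`; minimal supports always have codimension one (`finrank_of_minimal`). -/

open scoped Matrix

/-! ## The commuting evolution, entry by entry -/

/-- The rate at which the evolution generated by diagonal jump operators damps the coherence between
two basis states. -/
noncomputable def decayRate {d N : ℕ} (l₁ : Fin d → ℝ) (l : Fin N → Fin d → ℝ) (γ₁ : ℝ)
    (γ : Fin N → ℝ) (i j : Fin d) : ℝ :=
  (γ₁ * (l₁ i - l₁ j) ^ 2 + ∑ k, γ k * (l k i - l k j) ^ 2) / 2

theorem diagOp_kronecker_one {d a : ℕ} (v : Fin d → ℝ) :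
    diagOp v ⊗ₖ (1 : Matrix (Fin a) (Fin a) ℂ) =
      Matrix.diagonal fun x : Fin d × Fin a => (v x.1 : ℂ) := by
  rw [diagOp, ← Matrix.diagonal_one, Matrix.diagonal_kronecker_diagonal]
  simp

theorem dissipator_diagonal_apply {n : Type} [Fintype n] [DecidableEq n] (v : n → ℝ)
    (ρ : Matrix n n ℂ) (x y : n) :
    dissipator (Matrix.diagonal fun x => (v x : ℂ)) ρ x y =
      -(((v x - v y) ^ 2 / 2 : ℝ) : ℂ) * ρ x y := by
  have h : (Matrix.diagonal fun x => (v x : ℂ)).conjTranspose =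
      Matrix.diagonal fun x => (v x : ℂ) := by
    rw [Matrix.diagonal_conjTranspose]
    congr 1
    ext x
    simp
  simp only [dissipator, h, Matrix.diagonal_mul_diagonal, Matrix.sub_apply, Matrix.smul_apply,
    Matrix.add_apply, Matrix.mul_diagonal, Matrix.diagonal_mul, smul_eq_mul]
  push_cast
  ring

theorem lindbladian_iterate_apply {d N a : ℕ} (l₁ : Fin d → ℝ) (l : Fin N → Fin d → ℝ) (γ₁ : ℝ)
    (γ : Fin N → ℝ) (k : ℕ) (ρ : Matrix (Fin d × Fin a) (Fin d × Fin a) ℂ) (x y : Fin d × Fin a) :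
    (lindbladian (diagOp l₁ ⊗ₖ (1 : Matrix (Fin a) (Fin a) ℂ))
      (fun k => diagOp (l k) ⊗ₖ (1 : Matrix (Fin a) (Fin a) ℂ)) γ₁ γ)^[k] ρ x y =
      ((-decayRate l₁ l γ₁ γ x.1 y.1 : ℝ) : ℂ) ^ k * ρ x y := by
  induction k with
  | zero => simp
  | succ k ih =>
    rw [Function.iterate_succ_apply']
    simp only [lindbladian, diagOp_kronecker_one, Matrix.add_apply, Matrix.smul_apply,
      Matrix.sum_apply, dissipator_diagonal_apply (fun x : Fin d × Fin a => l₁ x.1),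
      fun k => dissipator_diagonal_apply (fun x : Fin d × Fin a => l k x.1), smul_eq_mul]
    simp only [diagOp_kronecker_one] at ih
    rw [ih, pow_succ' _ k, mul_assoc ((-decayRate l₁ l γ₁ γ x.1 y.1 : ℝ) : ℂ)]
    generalize ((-decayRate l₁ l γ₁ γ x.1 y.1 : ℝ) : ℂ) ^ k * ρ x y = z
    rw [decayRate]
    push_cast
    simp only [← mul_assoc, ← Finset.sum_mul]
    rw [← add_mul]
    congr 1
    rw [add_div, neg_add, Finset.sum_div, ← Finset.sum_neg_distrib]
    congr 1
    · ring
    · exact Finset.sum_congr rfl fun _ _ => by ring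

theorem extendedEvolve_apply {d N a : ℕ} (l₁ : Fin d → ℝ) (l : Fin N → Fin d → ℝ) (γ₁ : ℝ)
    (γ : Fin N → ℝ) (t : ℝ) (ρ : Matrix (Fin d × Fin a) (Fin d × Fin a) ℂ) (x y : Fin d × Fin a) :
    extendedEvolve a (diagOp l₁) (fun k => diagOp (l k)) γ₁ γ t ρ x y =
      (Real.exp (-(t * decayRate l₁ l γ₁ γ x.1 y.1)) : ℂ) * ρ x y := by
  suffices h : HasSum (fun k : ℕ => ((t ^ k / (k.factorial : ℝ) : ℝ) : ℂ) •
      (lindbladian (diagOp l₁ ⊗ₖ (1 : Matrix (Fin a) (Fin a) ℂ))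
      (fun k => diagOp (l k) ⊗ₖ (1 : Matrix (Fin a) (Fin a) ℂ)) γ₁ γ)^[k] ρ)
      (Matrix.of fun x y => (Real.exp (-(t * decayRate l₁ l γ₁ γ x.1 y.1)) : ℂ) * ρ x y) by
    rw [extendedEvolve, lindbladEvolve, h.tsum_eq, Matrix.of_apply]
  refine Pi.hasSum.2 fun x => Pi.hasSum.2 fun y => ?_
  simp only [Matrix.smul_apply, lindbladian_iterate_apply, Matrix.of_apply, smul_eq_mul]
  have h := (NormedSpace.expSeries_div_hasSum_exp (-(t * decayRate l₁ l γ₁ γ x.1 y.1)))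
  rw [← Real.exp_eq_exp_ℝ] at h
  refine ((Complex.hasSum_ofReal.2 h).mul_right (ρ x y)).congr_fun fun k => ?_
  push_cast
  ring

/-! ## Positive semidefinite matrices -/

namespace Matrix.PosSemidef

theorem of_tendsto {n : Type} [Finite n] {A : ℕ → Matrix n n ℂ} {B : Matrix n n ℂ}
    (hA : ∀ k, (A k).PosSemidef) (h : ∀ i j, Tendsto (fun k => A k i j) atTop (𝓝 (B i j))) :
    B.PosSemidef := by
  have := Fintype.ofFinite n
  have hB : Tendsto A atTop (𝓝 B) := tendsto_pi_nhds.2 fun i => tendsto_pi_nhds.2 (h i)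
  refine posSemidef_iff_dotProduct_mulVec.2 ⟨?_, fun x => ?_⟩
  · have h2 : Tendsto (fun k => (A k).conjTranspose) atTop (𝓝 B.conjTranspose) :=
      (continuous_id.matrix_conjTranspose.tendsto B).comp hB
    exact tendsto_nhds_unique (h2.congr fun k => (hA k).1) hB
  · have hc : Continuous fun C : Matrix n n ℂ => star x ⬝ᵥ (C *ᵥ x) := by fun_prop
    exact ge_of_tendsto' ((hc.tendsto B).comp hB) fun k => (hA k).dotProduct_mulVec_nonneg x

theorem hadamard_pow {n : Type} [Finite n] {A : Matrix n n ℂ} (hA : A.PosSemidef) (k : ℕ) :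
    (Matrix.of fun i j => A i j ^ k).PosSemidef := by
  induction k with
  | zero =>
    have := Fintype.ofFinite n
    convert posSemidef_vecMulVec_self_star (fun _ : n => (1 : ℂ)) using 1
    ext i j
    simp [vecMulVec_apply]
  | succ k ih =>
    have h := ih.hadamard hA
    rw [show (Matrix.of fun i j => A i j ^ (k + 1)) = (Matrix.of fun i j => A i j ^ k) ⊙ A from
      Matrix.ext fun i j => pow_succ _ _]
    exact h

/-- Schur powers are positive semidefinite, the exponential series has nonnegative coefficients, and
the cone is closed. -/
theorem map_exp {n : Type} [Finite n] {A : Matrix n n ℂ} (hA : A.PosSemidef) :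
    (Matrix.of fun i j => Complex.exp (A i j)).PosSemidef := by
  refine of_tendsto
    (A := fun m => ∑ k ∈ Finset.range m, ((k.factorial : ℂ)⁻¹) • Matrix.of fun i j => A i j ^ k)
    (fun m => posSemidef_sum _ fun k _ => (hA.hadamard_pow k).smul ?_) fun i j => ?_
  · rw [inv_nonneg]
    exact_mod_cast Nat.zero_le _
  · have h := (NormedSpace.expSeries_div_hasSum_exp (A i j)).tendsto_sum_nat
    rw [← Complex.exp_eq_exp_ℂ] at h
    refine h.congr fun m => ?_
    rw [Matrix.sum_apply]
    exact Finset.sum_congr rfl fun k _ => by simp [div_eq_inv_mul]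

/-- Expanding the square, the kernel is the entrywise exponential of `t` times a Gram matrix,
conjugated by a positive diagonal matrix. -/
theorem gaussianKernel {n κ : Type} [Finite n] [Fintype κ] (y : n → κ → ℝ) {t : ℝ} (ht : 0 ≤ t) :
    (Matrix.of fun i j =>
      (Real.exp (-(t * ((∑ c, (y i c - y j c) ^ 2) / 2))) : ℂ)).PosSemidef := by
  classical
  have := Fintype.ofFinite n
  have hG : (Matrix.of fun i j => ((t * ∑ c, y i c * y j c : ℝ) : ℂ)).PosSemidef := by
    have h := (posSemidef_self_mul_conjTranspose (Matrix.of fun i c => (y i c : ℂ))).smul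
      (show (0 : ℂ) ≤ (t : ℂ) by exact_mod_cast ht)
    convert h using 1
    ext i j
    simp [Matrix.mul_apply]
  have h := hG.map_exp.mul_mul_conjTranspose_same
    (Matrix.diagonal fun i => (Real.exp (-(t * ((∑ c, y i c ^ 2) / 2))) : ℂ))
  convert h using 1
  ext i j
  simp only [Matrix.of_apply, Matrix.diagonal_conjTranspose, Matrix.mul_diagonal,
    Matrix.diagonal_mul, Pi.star_apply, RCLike.star_def, Complex.conj_ofReal,
    ← Complex.ofReal_exp, ← Complex.ofReal_mul, ← Real.exp_add]
  congr 2
  simp only [sub_sq, Finset.sum_add_distrib, Finset.sum_sub_distrib, mul_assoc, ← Finset.mul_sum]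
  ring

/-- The trace is the quadratic form of the Schur product of `A` and the transpose of `B` at the
all-ones vector. -/
theorem trace_mul_nonneg {n : Type} [Fintype n] {A B : Matrix n n ℂ} (hA : A.PosSemidef)
    (hB : B.PosSemidef) : 0 ≤ (A * B).trace := by
  have h := (hA.hadamard hB.transpose).dotProduct_mulVec_nonneg fun _ => 1
  rw [← Matrix.transpose_transpose B, ← Matrix.sum_hadamard_eq]
  simpa [dotProduct, Matrix.mulVec] using h

end Matrix.PosSemidef

/-! ## Fisher information bounds from state overlaps -/

/-- Fisher information is four times the limit of the squared Hellinger distance over `s²`, since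
`(√p)' = p' / (2√p)`. -/
theorem classicalFisher_le_of_hellinger {m : ℕ} {p : ℝ → Fin m → ℝ} {θ b : ℝ}
    (hp : ∀ θ' x, 0 ≤ p θ' x)
    (h : ∀ᶠ s in 𝓝[≠] (0 : ℝ), ∑ x, (√(p (θ + s) x) - √(p θ x)) ^ 2 ≤ b * s ^ 2) :
    classicalFisher p θ ≤ ENNReal.ofReal (4 * b) := by
  set A : Fin m → ℝ := fun x => (deriv (fun θ' => p θ' x) θ) ^ 2 / p θ x with hA
  have hA0 : ∀ x, 0 ≤ A x := fun x => div_nonneg (sq_nonneg _) (hp _ _)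
  have key : ∀ x, ∃ g : ℝ → ℝ, Tendsto g (𝓝[≠] 0) (𝓝 (A x)) ∧
      ∀ s, s ≠ 0 → g s ≤ 4 * ((√(p (θ + s) x) - √(p θ x)) ^ 2 / s ^ 2) := by
    intro x
    by_cases h0 : p θ x ≠ 0 ∧ DifferentiableAt ℝ (fun θ' => p θ' x) θ
    · refine ⟨fun s => 4 * (s⁻¹ * (√(p (θ + s) x) - √(p θ x))) ^ 2, ?_, fun s _ => ?_⟩
      · have hd := (h0.2.hasDerivAt.sqrt h0.1).tendsto_slope_zero
        simp only [smul_eq_mul] at hd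
        have h1 := (hd.pow 2).const_mul 4
        convert h1 using 2
        rw [hA]
        have h2 : √(p θ x) ≠ 0 := (Real.sqrt_pos.2 (lt_of_le_of_ne (hp _ _) h0.1.symm)).ne'
        rw [div_pow, mul_pow, Real.sq_sqrt (hp _ _)]
        have := h0.1
        field_simp
        norm_num
      · apply le_of_eq
        simp only [mul_pow, inv_pow]
        ring
    -- An outcome of probability zero, or without derivative, contributes zero by the conventions
    -- for division and `deriv`.
    · refine ⟨fun _ => 0, ?_, fun s _ => by positivity⟩
      have : A x = 0 := by
        rw [not_and_or, not_not] at h0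
        rcases h0 with h0 | h0
        · simp [hA, h0]
        · simp [hA, deriv_zero_of_not_differentiableAt h0]
      rw [this]
      exact tendsto_const_nhds
  choose g hg hg' using key
  have hlim := tendsto_finsetSum Finset.univ fun x _ => hg x
  have hle : ∑ x, A x ≤ 4 * b := by
    refine le_of_tendsto hlim ?_
    filter_upwards [h, self_mem_nhdsWithin] with s hs hs0
    have hs0 : s ≠ 0 := hs0
    refine (Finset.sum_le_sum fun x _ => hg' x s hs0).trans ?_
    rw [← Finset.mul_sum, ← Finset.sum_div]
    gcongr
    rw [div_le_iff₀ (by positivity)]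
    exact hs
  rw [classicalFisher, ← ENNReal.ofReal_sum_of_nonneg fun x _ => hA0 x]
  exact ENNReal.ofReal_le_ofReal hle

/-- The matrix `X` couples `ρ` and `σ`: it is the off-diagonal block of a positive semidefinite
matrix with diagonal blocks `ρ` and `σ`. -/
def Coupled {n : Type} (ρ σ X : Matrix n n ℂ) : Prop :=
  (Matrix.fromBlocks ρ X X.conjTranspose σ).PosSemidef

namespace Coupled

variable {n : Type} {ρ σ X : Matrix n n ℂ}

theorem refl_of_posSemidef (hρ : ρ.PosSemidef) : Coupled ρ ρ ρ := by
  have h : Matrix.fromBlocks ρ ρ ρ.conjTranspose ρ =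
      ρ.submatrix (Sum.elim id id : n ⊕ n → n) (Sum.elim id id) := by
    rw [hρ.1]
    ext (i | i) (j | j) <;> rfl
  rw [Coupled, h]
  exact hρ.submatrix _

theorem hadamard (h : Coupled ρ σ X) {K : Matrix (n ⊕ n) (n ⊕ n) ℂ} (hK : K.PosSemidef) :
    Coupled (Matrix.of fun i j => K (.inl i) (.inl j) * ρ i j)
      (Matrix.of fun i j => K (.inr i) (.inr j) * σ i j)
      (Matrix.of fun i j => K (.inl i) (.inr j) * X i j) := by
  rw [Coupled]
  have h1 : Matrix.fromBlocks (Matrix.of fun i j => K (.inl i) (.inl j) * ρ i j)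
      (Matrix.of fun i j => K (.inl i) (.inr j) * X i j)
      (Matrix.of fun i j => K (.inl i) (.inr j) * X i j).conjTranspose
      (Matrix.of fun i j => K (.inr i) (.inr j) * σ i j) = K ⊙ Matrix.fromBlocks ρ X X.conjTranspose σ := by
    ext (i | i) (j | j)
    · rfl
    · rfl
    · simp [Matrix.conjTranspose_apply, ← hK.1.apply (.inr i) (.inl j)]
    · rfl
  rw [h1]
  exact Matrix.PosSemidef.hadamard hK h

variable [Fintype n]

theorem sum_conj [DecidableEq n] {r : ℕ} (h : Coupled ρ σ X) (K : Fin r → Matrix n n ℂ) :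
    Coupled (∑ j, K j * ρ * (K j).conjTranspose) (∑ j, K j * σ * (K j).conjTranspose)
      (∑ j, K j * X * (K j).conjTranspose) := by
  have h1 := Matrix.posSemidef_sum Finset.univ fun j _ =>
    Matrix.PosSemidef.mul_mul_conjTranspose_same h (Matrix.fromBlocks (K j) 0 0 (K j))
  rw [Coupled]
  convert h1 using 1
  ext (i | i) (j | j) <;>
  simp [Matrix.fromBlocks_conjTranspose, Matrix.fromBlocks_multiply, Matrix.sum_apply,
    Matrix.conjTranspose_sum, Matrix.mul_assoc]

theorem posSemidef_combination [DecidableEq n] (h : Coupled ρ σ X) (u v : ℝ) :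
    (((u ^ 2 : ℝ) : ℂ) • ρ + ((u * v : ℝ) : ℂ) • (X + X.conjTranspose)
      + ((v ^ 2 : ℝ) : ℂ) • σ).PosSemidef := by
  have h1 := Matrix.PosSemidef.mul_mul_conjTranspose_same h
    (Matrix.fromCols ((u : ℂ) • (1 : Matrix n n ℂ)) ((v : ℂ) • (1 : Matrix n n ℂ)))
  convert h1 using 1
  rw [Matrix.conjTranspose_fromCols_eq_fromRows_conjTranspose, Matrix.fromCols_mul_fromBlocks,
    Matrix.fromCols_mul_fromRows]
  ext i j
  simp
  ring

/-- Cauchy–Schwarz: the quadratic polynomial in `u` obtained by testing the block matrix against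
`(u, 1)` is nonnegative, so its discriminant is not positive. -/
theorem re_trace_sq_le [DecidableEq n] (h : Coupled ρ σ X) {E : Matrix n n ℂ}
    (hE : E.PosSemidef) :
    (E * X).trace.re ^ 2 ≤ (E * ρ).trace.re * (E * σ).trace.re := by
  have hX : (E * X.conjTranspose).trace.re = (E * X).trace.re := by
    rw [← Complex.conj_re, ← RCLike.star_def, ← Matrix.trace_conjTranspose,
      Matrix.conjTranspose_mul, Matrix.conjTranspose_conjTranspose, hE.1, Matrix.trace_mul_comm]
  have h1 : ∀ u : ℝ, 0 ≤ (E * ρ).trace.re * (u * u) + 2 * (E * X).trace.re * u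
      + (E * σ).trace.re := by
    intro u
    have h2 := (Complex.le_def.1 (hE.trace_mul_nonneg (h.posSemidef_combination u 1))).1
    simp only [Matrix.mul_add, Matrix.mul_smul, Matrix.trace_add, Matrix.trace_smul, smul_eq_mul,
      Complex.add_re, Complex.re_ofReal_mul, hX, Complex.zero_re] at h2
    linarith
  have h3 := discrim_le_zero h1
  rw [discrim] at h3
  linarith

theorem re_trace_le_sqrt [DecidableEq n] (h : Coupled ρ σ X) {E : Matrix n n ℂ}
    (hE : E.PosSemidef) :
    (E * X).trace.re ≤ √((E * ρ).trace.re) * √((E * σ).trace.re) := by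
  have hρ : 0 ≤ (E * ρ).trace.re := by
    have := (Complex.le_def.1 (hE.trace_mul_nonneg (h.posSemidef_combination 1 0))).1
    simpa using this
  rw [← Real.sqrt_mul hρ]
  exact Real.le_sqrt_of_sq_le (h.re_trace_sq_le hE)

theorem re_diag_le [DecidableEq n] (h : Coupled ρ σ X) (i : n) :
    2 * (X i i).re ≤ (ρ i i).re + (σ i i).re := by
  have h1 := (Complex.le_def.1 ((h.posSemidef_combination 1 (-1)).diag_nonneg (i := i))).1
  simp [Complex.add_re] at h1
  linarith

/-- The squared Hellinger distance is `2 - 2 ∑ √p √q`, and each product of roots dominates the real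
part of the trace of the effect against `X`. -/
theorem hellinger_le [DecidableEq n] {m : ℕ} (h : Coupled ρ σ X) (E : POVM n m)
    (hρ : ρ.trace = 1) (hσ : σ.trace = 1) {δ : ℝ} (hX : 1 - δ ≤ X.trace.re) :
    ∑ x, (√((E.effect x * σ).trace.re) - √((E.effect x * ρ).trace.re)) ^ 2 ≤ 2 * δ := by
  have hsum : ∀ Y : Matrix n n ℂ, ∑ x, (E.effect x * Y).trace.re = Y.trace.re := by
    intro Y
    rw [← Complex.re_sum, ← Matrix.trace_sum, ← Finset.sum_mul, E.sum_eq_one, one_mul]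
  have hpos : ∀ x, 0 ≤ (E.effect x * ρ).trace.re ∧ 0 ≤ (E.effect x * σ).trace.re := fun x => by
    have h1 := (Complex.le_def.1
      ((E.posSemidef x).trace_mul_nonneg (h.posSemidef_combination 1 0))).1
    have h2 := (Complex.le_def.1
      ((E.posSemidef x).trace_mul_nonneg (h.posSemidef_combination 0 1))).1
    exact ⟨by simpa using h1, by simpa using h2⟩
  calc _ ≤ ∑ x, ((E.effect x * σ).trace.re + (E.effect x * ρ).trace.re
        - 2 * (E.effect x * X).trace.re) := by
        refine Finset.sum_le_sum fun x _ => ?_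
        have h1 := h.re_trace_le_sqrt (E.posSemidef x)
        have h2 := Real.sq_sqrt (hpos x).1
        have h3 := Real.sq_sqrt (hpos x).2
        nlinarith
    _ ≤ 2 * δ := by
        rw [Finset.sum_sub_distrib, Finset.sum_add_distrib, ← Finset.mul_sum, hsum, hsum, hsum,
          hρ, hσ, Complex.one_re]
        linarith

end Coupled

theorem QuantumChannel.trace_apply {n : Type} [Fintype n] [DecidableEq n] (C : QuantumChannel n)
    (ρ : Matrix n n ℂ) : (C.apply ρ).trace = ρ.trace := by
  rw [QuantumChannel.apply, Matrix.trace_sum]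
  simp_rw [Matrix.trace_mul_comm (_ * ρ), ← Matrix.mul_assoc]
  rw [← Matrix.trace_sum, ← Finset.sum_mul, C.trace_preserving, one_mul]

theorem trace_extendedEvolve {d N a : ℕ} (l₁ : Fin d → ℝ) (l : Fin N → Fin d → ℝ) (γ₁ : ℝ)
    (γ : Fin N → ℝ) (t : ℝ) (ρ : Matrix (Fin d × Fin a) (Fin d × Fin a) ℂ) :
    (extendedEvolve a (diagOp l₁) (fun k => diagOp (l k)) γ₁ γ t ρ).trace = ρ.trace := by
  refine Finset.sum_congr rfl fun x _ => ?_
  simp [Matrix.diag, extendedEvolve_apply, decayRate]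

/-! ## Euclidean configurations of the jump amplitudes -/

/-- Half of the squared Euclidean distance. -/
noncomputable def halfSqDist {κ : Type} [Fintype κ] (u v : κ → ℝ) : ℝ := (∑ c, (u c - v c) ^ 2) / 2

/-- If the decay rates at two signal strengths are the half squared distances within two Euclidean
configurations, then the evolution preserves couplings. -/
theorem Coupled.evolve {d N a : ℕ} {l₁ : Fin d → ℝ} {l : Fin N → Fin d → ℝ} {γ₁ γ₁' : ℝ}
    {γ : Fin N → ℝ} {κ : Type} [Fintype κ] {y y' : Fin d → κ → ℝ}
    (hy : ∀ i j, decayRate l₁ l γ₁ γ i j = halfSqDist (y i) (y j))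
    (hy' : ∀ i j, decayRate l₁ l γ₁' γ i j = halfSqDist (y' i) (y' j)) {t : ℝ} (ht : 0 ≤ t)
    {ρ σ X : Matrix (Fin d × Fin a) (Fin d × Fin a) ℂ} (h : Coupled ρ σ X) :
    Coupled (extendedEvolve a (diagOp l₁) (fun k => diagOp (l k)) γ₁ γ t ρ)
      (extendedEvolve a (diagOp l₁) (fun k => diagOp (l k)) γ₁' γ t σ)
      (Matrix.of fun i j => (Real.exp (-(t * halfSqDist (y i.1) (y' j.1))) : ℂ) * X i j) := by
  -- One Gaussian kernel on two copies of the index set: its diagonal blocks are the damping factors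
  -- of the two evolutions, its off-diagonal block acts on `X`.
  have h1 := h.hadamard (Matrix.PosSemidef.gaussianKernel
    (Sum.elim (fun x : Fin d × Fin a => y x.1) (fun x => y' x.1)) ht)
  convert h1 using 1
  · ext i j
    simp [extendedEvolve_apply, hy, halfSqDist]
  · ext i j
    simp [extendedEvolve_apply, hy', halfSqDist]
  · ext i j
    simp [halfSqDist]

/-- Each diagonal entry loses at most a fraction `δ` of the bound `(ρᵢᵢ + σᵢᵢ) / 2` on `Re Xᵢᵢ`, and
these bounds sum to one. -/
theorem Coupled.re_trace_evolve {d a : ℕ} {κ : Type} [Fintype κ] {y y' : Fin d → κ → ℝ} {t δ : ℝ}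
    (ht : 0 ≤ t) (hδ : ∀ α, t * halfSqDist (y α) (y' α) ≤ δ) 
    {ρ σ X : Matrix (Fin d × Fin a) (Fin d × Fin a) ℂ} (h : Coupled ρ σ X) (hρ : ρ.trace = 1)
    (hσ : σ.trace = 1) :
    X.trace.re - δ ≤ (Matrix.of fun i j : Fin d × Fin a =>
      (Real.exp (-(t * halfSqDist (y i.1) (y' j.1))) : ℂ) * X i j).trace.re := by
  have hpos : ∀ i, 0 ≤ (ρ i i).re + (σ i i).re := fun i => by
    have h1 := (Complex.le_def.1 ((h.posSemidef_combination 1 0).diag_nonneg (i := i))).1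
    have h2 := (Complex.le_def.1 ((h.posSemidef_combination 0 1).diag_nonneg (i := i))).1
    simp at h1 h2
    linarith
  have hsum : ∑ i, ((ρ i i).re + (σ i i).re) = 2 := by
    have h1 := congrArg Complex.re hρ
    have h2 := congrArg Complex.re hσ
    simp only [Matrix.trace, Matrix.diag, Complex.re_sum, Complex.one_re] at h1 h2
    rw [Finset.sum_add_distrib, h1, h2]
    norm_num
  have h3 : ∀ i : Fin d × Fin a, (X i i).re - δ / 2 * ((ρ i i).re + (σ i i).re) ≤
      Real.exp (-(t * halfSqDist (y i.1) (y' i.1))) * (X i i).re := by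
    intro i
    have hq : 0 ≤ t * halfSqDist (y i.1) (y' i.1) :=
      mul_nonneg ht (div_nonneg (Finset.sum_nonneg fun _ _ => sq_nonneg _) zero_le_two)
    have he := Real.add_one_le_exp (-(t * halfSqDist (y i.1) (y' i.1)))
    have he1 : Real.exp (-(t * halfSqDist (y i.1) (y' i.1))) ≤ 1 :=
      Real.exp_le_one_iff.2 (neg_nonpos.2 hq)
    have h4 : (1 - Real.exp (-(t * halfSqDist (y i.1) (y' i.1)))) * (2 * (X i i).re) ≤
        δ * ((ρ i i).re + (σ i i).re) :=
      (mul_le_mul_of_nonneg_left (h.re_diag_le i) (by linarith)).trans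
        (mul_le_mul_of_nonneg_right (by linarith [hδ i.1]) (hpos i))
    linarith
  have h5 := Finset.sum_le_sum fun i (_ : i ∈ Finset.univ) => h3 i
  rw [Finset.sum_sub_distrib, ← Finset.mul_sum, hsum] at h5
  simp only [Matrix.trace, Matrix.diag, Complex.re_sum, Matrix.of_apply, Complex.re_ofReal_mul]
  linarith

/-- A control channel acts on all blocks with the same Kraus operators, so it preserves the coupling
and the trace of `X`; only the evolution loses overlap, and the losses add up over the rounds. -/
theorem exists_coupled_sequentialState {d N a : ℕ} {l₁ : Fin d → ℝ} {l : Fin N → Fin d → ℝ}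
    {γ₁ γ₁' : ℝ} {γ : Fin N → ℝ} {κ : Type} [Fintype κ] {y y' : Fin d → κ → ℝ}
    (hy : ∀ i j, decayRate l₁ l γ₁ γ i j = halfSqDist (y i) (y j))
    (hy' : ∀ i j, decayRate l₁ l γ₁' γ i j = halfSqDist (y' i) (y' j)) {t δ : ℝ} (ht : 0 ≤ t)
    (hδ : ∀ α, t * halfSqDist (y α) (y' α) ≤ δ)
    (ρ₀ : DensityMatrix (Fin d × Fin a)) (C : ℕ → QuantumChannel (Fin d × Fin a)) (k : ℕ) :
    let S := fun g => sequentialState a (diagOp l₁) (fun k => diagOp (l k)) g γ t C ρ₀.mat k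
    (S γ₁).trace = 1 ∧ (S γ₁').trace = 1 ∧
      ∃ X, Coupled (S γ₁) (S γ₁') X ∧ 1 - k * δ ≤ X.trace.re := by
  have hS : ∀ g k, sequentialState a (diagOp l₁) (fun k => diagOp (l k)) g γ t C ρ₀.mat (k + 1) =
      (C k).apply (extendedEvolve a (diagOp l₁) (fun k => diagOp (l k)) g γ t
        (sequentialState a (diagOp l₁) (fun k => diagOp (l k)) g γ t C ρ₀.mat k)) :=
    fun _ _ => rfl
  intro S
  simp only [S]
  induction k with
  | zero =>
    exact ⟨ρ₀.trace_eq_one, ρ₀.trace_eq_one, ρ₀.mat, Coupled.refl_of_posSemidef ρ₀.posSemidef,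
      by simp [ρ₀.trace_eq_one]⟩
  | succ k ih =>
    obtain ⟨h1, h2, X, hX, hX'⟩ := ih
    refine ⟨?_, ?_, _, (hX.evolve hy hy' ht).sum_conj (C k).kraus, ?_⟩
    · rw [hS, QuantumChannel.trace_apply, trace_extendedEvolve, h1]
    · rw [hS, QuantumChannel.trace_apply, trace_extendedEvolve, h2]
    · have h3 := (C k).trace_apply (Matrix.of fun i j : Fin d × Fin a =>
        (Real.exp (-(t * halfSqDist (y i.1) (y' j.1))) : ℂ) * X i j)
      rw [QuantumChannel.apply] at h3
      rw [h3]
      refine le_trans ?_ (hX.re_trace_evolve ht hδ h1 h2)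
      rw [Nat.cast_succ]
      linarith

/-- The noiseResidual of the signal after subtraction of a combination of `1` and the noises. -/
def noiseResidual {d N : ℕ} (l₁ : Fin d → ℝ) (l : Fin N → Fin d → ℝ) (c₀ : ℝ) (c : Fin N → ℝ)
    (α : Fin d) : ℝ :=
  l₁ α - c₀ - ∑ k, c k * l k α

/-- The squared displacement per squared parameter change `h` of the jump amplitude of level `α`, in
the frame that rotates with velocity `c` and moves with velocity `c₀`. -/
noncomputable def displacement {d N : ℕ} (l₁ : Fin d → ℝ) (l : Fin N → Fin d → ℝ) (γ : Fin N → ℝ)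
    (θ c₀ : ℝ) (c : Fin N → ℝ) (α : Fin d) (h : ℝ) : ℝ :=
  ((noiseResidual l₁ l c₀ c α
      - h * (∑ k, c k ^ 2 / γ k) / 4 * ((θ + h) * l₁ α + h * c₀ + θ * l₁ α)) ^ 2
    + (∑ k, c k ^ 2 / γ k) / 4 * (2 * (θ + h) * l₁ α - h * ∑ k, c k * l k α) ^ 2)
    / (1 + h ^ 2 * (∑ k, c k ^ 2 / γ k) / 4) ^ 2

/-- This is the freedom of mixing jump operators and shifting them by multiples of the identity,
seen as isometries of the configuration; `c₀` and `c` are the velocities of this motion. -/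
theorem exists_configurations {d N : ℕ} (l₁ : Fin d → ℝ) (l : Fin N → Fin d → ℝ)
    {γ : Fin N → ℝ} (hγ : ∀ k, 0 < γ k) (θ c₀ : ℝ) (c : Fin N → ℝ) (h : ℝ) :
    ∃ y y' : Fin d → Option (Fin N) → ℝ,
      (∀ i j, decayRate l₁ l (θ ^ 2) γ i j = halfSqDist (y i) (y j)) ∧
      (∀ i j, decayRate l₁ l ((θ + h) ^ 2) γ i j = halfSqDist (y' i) (y' j)) ∧
      ∀ α, halfSqDist (y α) (y' α) = h ^ 2 * displacement l₁ l γ θ c₀ c α h / 2 := by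
  set κ := (∑ k, c k ^ 2 / γ k) / 4 with hκ
  have hκ0 : 0 ≤ κ := div_nonneg
    (Finset.sum_nonneg fun k _ => div_nonneg (sq_nonneg _) (hγ k).le) (by norm_num)
  have hD : 0 < 1 + h ^ 2 * κ := by positivity
  set v : Fin d → ℝ := fun α => ∑ k, c k * l k α with hv
  set q : Fin d → ℝ := fun α => (2 * ((θ + h) * l₁ α) - h * v α) / (1 + h ^ 2 * κ) with hq
  have hs : ∀ k, √(γ k) ≠ 0 := fun k => (Real.sqrt_pos.2 (hγ k)).ne'
  have hs2 : ∀ k, √(γ k) ^ 2 = γ k := fun k => Real.sq_sqrt (hγ k).le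
  have hcc : ∑ k, (c k / √(γ k)) ^ 2 = 4 * κ := by
    rw [hκ]
    simp_rw [div_pow, hs2]
    ring
  -- With `x = (θ + h) l₁`, `z = √γ l` and `u = (h / 2) c / √γ`, the second configuration is `(q -
  -- x, z + q u)` up to translation, where `q = 2 (x - u·z) / (1 + |u|²)` and `|u|² = h² κ`. It is
  -- the composition of the reflections along `(1, 0)` and `(1, u)`, hence an exact rotation with
  -- rational coefficients.
  refine ⟨fun α o => o.elim (θ * l₁ α) fun k => √(γ k) * l k α,
    fun α o => o.elim (((1 - h ^ 2 * κ) * ((θ + h) * l₁ α) - h * v α) / (1 + h ^ 2 * κ) - h * c₀)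
      fun k => √(γ k) * l k α + h / 2 * (c k / √(γ k)) * q α, ?_, ?_, ?_⟩
  · intro i j
    simp only [decayRate, halfSqDist, Fintype.sum_option, Option.elim]
    congr 2
    · ring
    · refine Finset.sum_congr rfl fun k _ => ?_
      rw [← mul_sub, mul_pow, hs2]
  · intro i j
    simp only [decayRate, halfSqDist, Fintype.sum_option, Option.elim]
    have h1 : ∑ k, (√(γ k) * l k i + h / 2 * (c k / √(γ k)) * q i
        - (√(γ k) * l k j + h / 2 * (c k / √(γ k)) * q j)) ^ 2 =
        ∑ k, γ k * (l k i - l k j) ^ 2 + h * (q i - q j) * (v i - v j)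
          + h ^ 2 / 4 * (q i - q j) ^ 2 * (4 * κ) := by
      rw [← hcc, hv]
      simp only [← Finset.sum_sub_distrib, Finset.mul_sum, ← Finset.sum_add_distrib]
      refine Finset.sum_congr rfl fun k _ => ?_
      have h1 := hs k
      have h2 := hs2 k
      generalize √(γ k) = s at h1 h2 ⊢
      rw [← h2]
      field_simp
      ring
    rw [h1]
    simp only [hq]
    field_simp
    ring
  · intro α
    simp only [halfSqDist, Fintype.sum_option, Option.elim]
    have h1 : ∑ k, (√(γ k) * l k α - (√(γ k) * l k α + h / 2 * (c k / √(γ k)) * q α)) ^ 2 =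
        h ^ 2 / 4 * q α ^ 2 * (4 * κ) := by
      rw [← hcc, Finset.mul_sum]
      exact Finset.sum_congr rfl fun k _ => by ring
    rw [h1, displacement, noiseResidual]
    have e1 : ∀ z : ℝ, z * (∑ k, c k ^ 2 / γ k) / 4 = z * κ := fun z => by rw [hκ]; ring
    rw [e1, e1, ← hκ]
    change _ = h ^ 2 * (((l₁ α - c₀ - v α - _) ^ 2 + κ * (2 * (θ + h) * l₁ α - h * v α) ^ 2) / _) / 2
    simp only [hq]
    field_simp
    ring

theorem tendsto_displacement {d N : ℕ} (l₁ : Fin d → ℝ) (l : Fin N → Fin d → ℝ) {γ : Fin N → ℝ}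
    (θ c₀ : ℝ) (c : Fin N → ℝ) (α : Fin d) :
    Tendsto (displacement l₁ l γ θ c₀ c α) (𝓝[≠] 0)
      (𝓝 (noiseResidual l₁ l c₀ c α ^ 2 + (∑ k, c k ^ 2 / γ k) * (θ * l₁ α) ^ 2)) := by
  have h : ContinuousAt (displacement l₁ l γ θ c₀ c α) 0 := by
    unfold displacement
    refine ContinuousAt.div (by fun_prop) (by fun_prop) (by simp)
  convert (h.tendsto.mono_left nhdsWithin_le_nhds) using 2
  simp [displacement]
  ring

/-! ### Upper bounds on the quantum Fisher information. -/

/-- The `M` rounds cost at most `T h² b / 2` of overlap together, whatever the controls; `M` cancels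
against the round duration `T / M`. -/
theorem sequentialQFI_le {d N : ℕ} (l₁ : Fin d → ℝ) (l : Fin N → Fin d → ℝ) {γ : Fin N → ℝ}
    (hγ : ∀ k, 0 < γ k) {T : ℝ} (hT : 0 < T) (θ c₀ : ℝ) (c : Fin N → ℝ) {b : ℝ}
    (hb : ∀ α, noiseResidual l₁ l c₀ c α ^ 2 + (∑ k, c k ^ 2 / γ k) * (θ * l₁ α) ^ 2 < b)
    {M : ℕ} (hM : 0 < M) :
    sequentialQFI (diagOp l₁) (fun k => diagOp (l k)) γ T M θ ≤ ENNReal.ofReal (4 * (T * b)) := by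
  refine iSup_le fun a => iSup_le fun ρ₀ => iSup_le fun C => iSup_le fun m => iSup_le fun E => ?_
  have hM' : (0 : ℝ) < M := by exact_mod_cast hM
  have hev : ∀ᶠ h in 𝓝[≠] (0 : ℝ), ∀ α, displacement l₁ l γ θ c₀ c α h < b :=
    Filter.eventually_all.2 fun α => (tendsto_displacement l₁ l θ c₀ c α).eventually_lt_const (hb α)
  have hcoup : ∀ h b', (∀ α, displacement l₁ l γ θ c₀ c α h ≤ b') →
      let S := fun θ' : ℝ => sequentialState a (diagOp l₁) (fun k => diagOp (l k)) (θ' ^ 2) γ (T / M)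
        C ρ₀.mat M
      (S θ).trace = 1 ∧ (S (θ + h)).trace = 1 ∧
      ∃ X, Coupled (S θ) (S (θ + h)) X ∧ 1 - M * (T / M * (h ^ 2 * b' / 2)) ≤ X.trace.re := by
    intro h b' hd
    obtain ⟨y, y', hy, hy', hyy⟩ := exists_configurations l₁ l hγ θ c₀ c h
    refine exists_coupled_sequentialState hy hy' (by positivity) (fun α => ?_) ρ₀ C M
    rw [hyy]
    gcongr
    exact hd α
  refine classicalFisher_le_of_hellinger (fun θ' x => ?_) ?_
  -- Nonnegativity of the outcome probabilities at an arbitrary `θ'` is read off the second diagonal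
  -- block of a coupling; any bound on the displacements serves.
  · obtain ⟨b', hb'⟩ := (Set.finite_range fun α => displacement l₁ l γ θ c₀ c α (θ' - θ)).bddAbove
    obtain ⟨-, -, X, hX, -⟩ := hcoup (θ' - θ) b' fun α => hb' ⟨α, rfl⟩
    have h2 := (Complex.le_def.1
      ((E.posSemidef x).trace_mul_nonneg (hX.posSemidef_combination 0 1))).1
    simpa using h2
  · filter_upwards [hev] with h hh
    obtain ⟨h1, h2, X, hX, hX'⟩ := hcoup h b fun α => (hh α).le
    refine (hX.hellinger_le E h1 h2 hX').trans (le_of_eq ?_)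
    field_simp

/-- In a single round from a known state the diagonal of `X` carries the populations, so the loss is
the `p`-average of the displacements instead of their maximum. -/
theorem quantumFisher_extendedEvolve_le {d N a : ℕ} (l₁ : Fin d → ℝ) (l : Fin N → Fin d → ℝ)
    {γ : Fin N → ℝ} (hγ : ∀ k, 0 < γ k) {t : ℝ} (ht : 0 ≤ t) (θ c₀ : ℝ) (c : Fin N → ℝ) {b : ℝ}
    {p : Fin d → ℝ} (hp : ∑ α, p α = 1) {ψ : Fin d × Fin a → ℂ}
    (hψ : ∀ α, ∑ β, ‖ψ (α, β)‖ ^ 2 = p α)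
    (hb : ∑ α, p α *
      (noiseResidual l₁ l c₀ c α ^ 2 + (∑ k, c k ^ 2 / γ k) * (θ * l₁ α) ^ 2) < b) :
    quantumFisher (fun θ' => extendedEvolve a (diagOp l₁) (fun k => diagOp (l k)) (θ' ^ 2) γ t
      (Matrix.vecMulVec ψ (star ψ))) θ ≤ ENNReal.ofReal (4 * (t * b)) := by
  refine iSup_le fun m => iSup_le fun E => ?_
  have hev : ∀ᶠ h in 𝓝[≠] (0 : ℝ), ∑ α, p α * displacement l₁ l γ θ c₀ c α h < b :=
    (tendsto_finsetSum _ fun α _ =>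
      (tendsto_displacement l₁ l θ c₀ c α).const_mul (p α)).eventually_lt_const hb
  have htr : (Matrix.vecMulVec ψ (star ψ)).trace = 1 := by
    have h1 : ∑ x, ‖ψ x‖ ^ 2 = 1 := by rw [Fintype.sum_prod_type, ← hp]; simp [hψ]
    rw [Matrix.trace_vecMulVec, dotProduct]
    simp only [Pi.star_apply, RCLike.star_def, Complex.mul_conj, Complex.normSq_eq_norm_sq]
    exact_mod_cast h1
  have hcoup : ∀ h,
      let S := fun θ' : ℝ => extendedEvolve a (diagOp l₁) (fun k => diagOp (l k)) (θ' ^ 2) γ t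
        (Matrix.vecMulVec ψ (star ψ))
      ∃ X, Coupled (S θ) (S (θ + h)) X ∧
        1 - t * (h ^ 2 * (∑ α, p α * displacement l₁ l γ θ c₀ c α h) / 2) ≤ X.trace.re := by
    intro h
    obtain ⟨y, y', hy, hy', hyy⟩ := exists_configurations l₁ l hγ θ c₀ c h
    refine ⟨_, (Coupled.refl_of_posSemidef (Matrix.posSemidef_vecMulVec_self_star ψ)).evolve
      hy hy' ht, ?_⟩
    have h1 : ∀ x : Fin d × Fin a, ((Real.exp (-(t * halfSqDist (y x.1) (y' x.1))) : ℂ) *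
        Matrix.vecMulVec ψ (star ψ) x x).re =
        Real.exp (-(t * halfSqDist (y x.1) (y' x.1))) * ‖ψ x‖ ^ 2 := by
      intro x
      rw [Complex.re_ofReal_mul, Matrix.vecMulVec_apply, Pi.star_apply, RCLike.star_def,
        Complex.mul_conj, Complex.normSq_eq_norm_sq, Complex.ofReal_re]
    simp only [Matrix.trace, Matrix.diag, Complex.re_sum, Matrix.of_apply, h1]
    rw [Fintype.sum_prod_type]
    simp only [← Finset.mul_sum, hψ]
    have h2 : ∀ α, p α - t * (h ^ 2 * (p α * displacement l₁ l γ θ c₀ c α h) / 2) ≤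
        Real.exp (-(t * halfSqDist (y α) (y' α))) * p α := by
      intro α
      have h3 := mul_le_mul_of_nonneg_right
        (Real.add_one_le_exp (-(t * halfSqDist (y α) (y' α))))
        ((hψ α).symm ▸ Finset.sum_nonneg fun β _ => by positivity : 0 ≤ p α)
      rw [hyy] at h3 ⊢
      linarith
    have h4 := Finset.sum_le_sum fun α (_ : α ∈ Finset.univ) => h2 α
    rw [Finset.sum_sub_distrib, hp, ← Finset.mul_sum, ← Finset.sum_div, ← Finset.mul_sum] at h4
    exact h4
  refine classicalFisher_le_of_hellinger (fun θ' x => ?_) ?_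
  · obtain ⟨X, hX, -⟩ := hcoup (θ' - θ)
    have h2 := (Complex.le_def.1
      ((E.posSemidef x).trace_mul_nonneg (hX.posSemidef_combination 0 1))).1
    simpa using h2
  · filter_upwards [hev] with h hh
    obtain ⟨X, hX, hX'⟩ := hcoup h
    refine (hX.hellinger_le E ?_ ?_ hX').trans ?_
    · rw [trace_extendedEvolve, htr]
    · rw [trace_extendedEvolve, htr]
    · have : h ^ 2 * (∑ α, p α * displacement l₁ l γ θ c₀ c α h) ≤ h ^ 2 * b := by gcongr
      nlinarith

/-! ## Detection of signal jumps -/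

/-- The probability, after a time `t`, to find a state with populations `p` along the image of this
state under `diag r`, where `q = p r` and `s = ∑ p r²`. -/
noncomputable def jumpProb {d N : ℕ} (l₁ : Fin d → ℝ) (l : Fin N → Fin d → ℝ) (γ : Fin N → ℝ)
    (q : Fin d → ℝ) (s t θ : ℝ) : ℝ :=
  (∑ i, ∑ j, q i * q j * Real.exp (-(t * decayRate l₁ l (θ ^ 2) γ i j))) / s

/-- The derivative of `jumpProb` with respect to the parameter. -/
noncomputable def jumpProbDeriv {d N : ℕ} (l₁ : Fin d → ℝ) (l : Fin N → Fin d → ℝ) (γ : Fin N → ℝ)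
    (q : Fin d → ℝ) (s t θ : ℝ) : ℝ :=
  t * ((∑ i, ∑ j, q i * q j * (Real.exp (-(t * decayRate l₁ l (θ ^ 2) γ i j)) *
    -(θ * (l₁ i - l₁ j) ^ 2))) / s)

section JumpProb

variable {d N : ℕ} (l₁ : Fin d → ℝ) (l : Fin N → Fin d → ℝ) (γ : Fin N → ℝ) {q : Fin d → ℝ} {s : ℝ}

theorem hasDerivAt_jumpProb (q : Fin d → ℝ) (s t θ : ℝ) :
    HasDerivAt (jumpProb l₁ l γ q s t) (jumpProbDeriv l₁ l γ q s t θ) θ := by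
  have h : ∀ i j, HasDerivAt
      (fun θ : ℝ => q i * q j * Real.exp (-(t * decayRate l₁ l (θ ^ 2) γ i j)))
      (q i * q j * (Real.exp (-(t * decayRate l₁ l (θ ^ 2) γ i j)) *
        -(t * ((2 * θ * (l₁ i - l₁ j) ^ 2) / 2)))) θ := by
    intro i j
    refine HasDerivAt.const_mul _ (HasDerivAt.exp (HasDerivAt.neg (HasDerivAt.const_mul _ ?_)))
    unfold decayRate
    refine HasDerivAt.div_const (HasDerivAt.add_const _ (HasDerivAt.mul_const ?_ _)) _
    simpa using hasDerivAt_pow 2 θ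
  have h2 := (HasDerivAt.fun_sum (u := Finset.univ) fun i _ =>
    HasDerivAt.fun_sum (u := Finset.univ) fun j _ => h i j).div_const s
  refine h2.congr_deriv ?_
  rw [jumpProbDeriv, mul_div_assoc', Finset.mul_sum]
  simp only [Finset.mul_sum]
  congr 1
  exact Finset.sum_congr rfl fun i _ => Finset.sum_congr rfl fun j _ => by ring

variable {l₁ l}

/-- As `q` sums to zero, only the cross term of the square survives. -/
theorem sum_mul_sq_sub (hq : ∑ i, q i = 0) (x : Fin d → ℝ) :
    ∑ i, ∑ j, q i * q j * (x i - x j) ^ 2 = -2 * (∑ i, q i * x i) ^ 2 := by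
  have h : ∀ i j, q i * q j * (x i - x j) ^ 2 =
      (q i * x i ^ 2) * q j + q i * (q j * x j ^ 2) - 2 * ((q i * x i) * (q j * x j)) :=
    fun i j => by ring
  simp only [h, Finset.sum_add_distrib, Finset.sum_sub_distrib, ← Finset.mul_sum, ← Finset.sum_mul,
    hq]
  ring

/-- Orthogonality of `q` to the noises removes them from the first-order transition probability,
leaving the signal alone. -/
theorem sum_mul_decayRate (hq : ∑ i, q i = 0) (hql : ∀ k, ∑ i, q i * l k i = 0)
    (hql₁ : ∑ i, q i * l₁ i = s) (g : ℝ) :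
    ∑ i, ∑ j, q i * q j * decayRate l₁ l g γ i j = -(g * s ^ 2) := by
  have h : ∀ i j, q i * q j * decayRate l₁ l g γ i j =
      g / 2 * (q i * q j * (l₁ i - l₁ j) ^ 2)
        + ∑ k, γ k / 2 * (q i * q j * (l k i - l k j) ^ 2) := by
    intro i j
    rw [decayRate, add_div, Finset.sum_div, mul_add, Finset.mul_sum]
    congr 1
    · ring
    · exact Finset.sum_congr rfl fun k _ => by ring
  simp only [h, Finset.sum_add_distrib, ← Finset.mul_sum]
  have h2 : ∑ i, ∑ j, ∑ k, γ k / 2 * (q i * q j * (l k i - l k j) ^ 2) = 0 := by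
    simp_rw [fun i => Finset.sum_comm (s := Finset.univ) (t := Finset.univ)
      (f := fun j k => γ k / 2 * (q i * q j * (l k i - l k j) ^ 2))]
    rw [Finset.sum_comm]
    refine Finset.sum_eq_zero fun k _ => ?_
    simp only [← Finset.mul_sum]
    rw [sum_mul_sq_sub hq, hql]
    simp
  rw [sum_mul_sq_sub hq, h2, hql₁]
  ring

theorem jumpProb_zero (hq : ∑ i, q i = 0) (θ : ℝ) : jumpProb l₁ l γ q s 0 θ = 0 := by
  simp [jumpProb, ← Finset.mul_sum, hq]

theorem tendsto_time_step {T : ℝ} (hT : 0 < T) :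
    Tendsto (fun M : ℕ => T / (M : ℝ)) atTop (𝓝[>] 0) := by
  refine tendsto_nhdsWithin_iff.2 ⟨tendsto_const_div_atTop_nhds_zero_nat T, ?_⟩
  filter_upwards [eventually_gt_atTop 0] with M hM
  have : (0 : ℝ) < M := by exact_mod_cast hM
  exact div_pos hT this

theorem tendsto_mul_jumpProb (hq : ∑ i, q i = 0) (hql : ∀ k, ∑ i, q i * l k i = 0)
    (hql₁ : ∑ i, q i * l₁ i = s) (hs : 0 < s) {T : ℝ} (hT : 0 < T) (θ : ℝ) :
    Tendsto (fun M : ℕ => M * jumpProb l₁ l γ q s (T / M) θ) atTop (𝓝 (T * (θ ^ 2 * s))) := by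
  have h : ∀ i j, HasDerivAt
      (fun t : ℝ => q i * q j * Real.exp (-(t * decayRate l₁ l (θ ^ 2) γ i j)))
      (q i * q j * (Real.exp (-(0 * decayRate l₁ l (θ ^ 2) γ i j)) *
        -(1 * decayRate l₁ l (θ ^ 2) γ i j))) 0 := by
    intro i j
    exact HasDerivAt.const_mul _ (HasDerivAt.exp
      (HasDerivAt.neg (HasDerivAt.mul_const (hasDerivAt_id (0 : ℝ)) _)))
  have h2 := (HasDerivAt.fun_sum (u := Finset.univ) fun i _ =>
    HasDerivAt.fun_sum (u := Finset.univ) fun j _ => h i j).div_const s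
  have h3 : (∑ i, ∑ j, q i * q j * (Real.exp (-(0 * decayRate l₁ l (θ ^ 2) γ i j)) *
      -(1 * decayRate l₁ l (θ ^ 2) γ i j))) / s = θ ^ 2 * s := by
    simp only [zero_mul, neg_zero, Real.exp_zero, one_mul, mul_neg, Finset.sum_neg_distrib]
    rw [sum_mul_decayRate γ hq hql hql₁]
    field_simp
  rw [h3] at h2
  have h4 := (h2.tendsto_slope_zero_right.comp (tendsto_time_step hT)).const_mul T
  refine h4.congr' ?_
  filter_upwards [eventually_gt_atTop 0] with M hM
  have hM' : (M : ℝ) ≠ 0 := by exact_mod_cast hM.ne'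
  have h0 := jumpProb_zero (l₁ := l₁) (l := l) (s := s) γ hq θ
  rw [jumpProb] at h0
  simp only [Function.comp_apply, zero_add, smul_eq_mul, h0]
  rw [sub_zero, jumpProb, inv_div, ← mul_assoc]
  congr 1
  field_simp

theorem tendsto_mul_jumpProbDeriv (hq : ∑ i, q i = 0)
    (hql₁ : ∑ i, q i * l₁ i = s) (hs : 0 < s) {T : ℝ} (hT : 0 < T) (θ : ℝ) :
    Tendsto (fun M : ℕ => M * jumpProbDeriv l₁ l γ q s (T / M) θ) atTop (𝓝 (T * (2 * θ * s))) := by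
  have hc : Continuous fun t : ℝ =>
      (∑ i, ∑ j, q i * q j * (Real.exp (-(t * decayRate l₁ l (θ ^ 2) γ i j)) *
        -(θ * (l₁ i - l₁ j) ^ 2))) / s := by fun_prop
  have h1 := ((hc.tendsto 0).comp
    ((tendsto_time_step hT).mono_right nhdsWithin_le_nhds)).const_mul T
  have h2 : (∑ i, ∑ j, q i * q j * (Real.exp (-(0 * decayRate l₁ l (θ ^ 2) γ i j)) *
      -(θ * (l₁ i - l₁ j) ^ 2))) / s = 2 * θ * s := by
    simp only [zero_mul, neg_zero, Real.exp_zero, one_mul, mul_neg, mul_left_comm _ θ,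
      Finset.sum_neg_distrib, ← Finset.mul_sum]
    rw [sum_mul_sq_sub hq, hql₁]
    field_simp
  rw [h2] at h1
  refine h1.congr' ?_
  filter_upwards [eventually_gt_atTop 0] with M hM
  have hM' : (M : ℝ) ≠ 0 := by exact_mod_cast hM.ne'
  simp only [Function.comp_apply, jumpProbDeriv]
  rw [← mul_assoc (M : ℝ), mul_div_cancel₀ _ hM']

/-- The accumulated probability tends to `T θ² s` and its derivative to `2 T θ s`, so `θ` cancels in
the Fisher ratio: the information stays finite as the signal vanishes. -/
theorem tendsto_mul_jumpProb_fisher (hq : ∑ i, q i = 0) (hql : ∀ k, ∑ i, q i * l k i = 0)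
    (hql₁ : ∑ i, q i * l₁ i = s) (hs : 0 < s) {T : ℝ} (hT : 0 < T) {θ : ℝ} (hθ : 0 < θ) :
    Tendsto (fun M : ℕ => (M * jumpProbDeriv l₁ l γ q s (T / M) θ) ^ 2 /
      (M * jumpProb l₁ l γ q s (T / M) θ)) atTop (𝓝 (4 * T * s)) := by
  have h := ((tendsto_mul_jumpProbDeriv (l := l) γ hq hql₁ hs hT θ).pow 2).div
    (tendsto_mul_jumpProb γ hq hql hql₁ hs hT θ) (by positivity)
  have e : (T * (2 * θ * s)) ^ 2 / (T * (θ ^ 2 * s)) = 4 * T * s := by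
    field_simp
    ring
  rw [e] at h
  exact h

end JumpProb

/-! ## Projective measurements and measure-and-prepare channels -/

theorem posSemidef_of_projection {n : Type} [Fintype n] {Q : Matrix n n ℂ}
    (hQ : Q.conjTranspose = Q) (hQQ : Q * Q = Q) :
    Q.PosSemidef := by
  have h := Matrix.posSemidef_conjTranspose_mul_self Q
  rwa [hQ, hQQ] at h

section Projection

variable {n : Type} [Fintype n] [DecidableEq n]

theorem complement_projection {Q : Matrix n n ℂ} (hQ : Q.conjTranspose = Q) (hQQ : Q * Q = Q) :
    (1 - Q).conjTranspose = 1 - Q ∧ (1 - Q) * (1 - Q) = 1 - Q := by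
  refine ⟨by simp [hQ], ?_⟩
  simp [sub_mul, mul_sub, hQQ]

/-- The measurement `{Q, 1 - Q}` of a projection. -/
def binaryPOVM (Q : Matrix n n ℂ) (hQ : Q.conjTranspose = Q) (hQQ : Q * Q = Q) : POVM n 2 where
  effect := ![Q, 1 - Q]
  posSemidef x := by
    fin_cases x
    · exact posSemidef_of_projection hQ hQQ
    · exact posSemidef_of_projection (complement_projection hQ hQQ).1
        (complement_projection hQ hQQ).2
  sum_eq_one := by simp

theorem le_quantumFisher {ρ : ℝ → Matrix n n ℂ} {Q : Matrix n n ℂ} (hQ : Q.conjTranspose = Q)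
    (hQQ : Q * Q = Q) {f : ℝ → ℝ} (hf : ∀ θ, (Q * ρ θ).trace = (f θ : ℂ)) {θ f' : ℝ}
    (hf' : HasDerivAt f f' θ) :
    ENNReal.ofReal (f' ^ 2 / f θ) ≤ quantumFisher ρ θ := by
  refine le_iSup_of_le 2 (le_iSup_of_le (binaryPOVM Q hQ hQQ) ?_)
  rw [classicalFisher]
  refine le_trans ?_ (Finset.single_le_sum (fun _ _ => zero_le) (Finset.mem_univ (0 : Fin 2)))
  have h : (fun θ' => ((binaryPOVM Q hQ hQQ).effect 0 * ρ θ').trace.re) = f := by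
    ext θ'
    simp [binaryPOVM, hf]
  have h0 := congrFun h θ
  simp only [h0, h, hf'.deriv]
  exact le_rfl

theorem exists_channel {κ : Type} [Fintype κ] (K : κ → Matrix n n ℂ)
    (hK : ∑ x, (K x).conjTranspose * K x = 1) :
    ∃ C : QuantumChannel n, ∀ ρ, C.apply ρ = ∑ x, K x * ρ * (K x).conjTranspose := by
  refine ⟨⟨Fintype.card κ, fun j => K ((Fintype.equivFin κ).symm j), ?_⟩, fun ρ => ?_⟩
  · rw [← hK]
    exact Equiv.sum_comp (Fintype.equivFin κ).symm fun x => (K x).conjTranspose * K x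
  · exact Equiv.sum_comp (Fintype.equivFin κ).symm fun x => K x * ρ * (K x).conjTranspose

/-- Kraus operators: the prepared vector times a row of the projection, for the projection and its
complement. Squaring the projection gives both trace preservation and the outcome weights. -/
theorem exists_measure_prepare_channel {Q : Matrix n n ℂ} (hQ : Q.conjTranspose = Q)
    (hQQ : Q * Q = Q) (φ : Fin 2 → n → ℂ) (hφ : ∀ b, star (φ b) ⬝ᵥ φ b = 1) :
    ∃ C : QuantumChannel n, ∀ ρ, C.apply ρ =
      ((1 - Q) * ρ).trace • Matrix.vecMulVec (φ 0) (star (φ 0)) +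
      (Q * ρ).trace • Matrix.vecMulVec (φ 1) (star (φ 1)) := by
  obtain ⟨hP, hPP⟩ := complement_projection hQ hQQ
  have key : ∀ (A : Matrix n n ℂ) (v : n → ℂ), A.conjTranspose = A → A * A = A →
      star v ⬝ᵥ v = 1 →
      (∑ x, (Matrix.vecMulVec v (A x)).conjTranspose * Matrix.vecMulVec v (A x) = A) ∧
      ∀ ρ, ∑ x, Matrix.vecMulVec v (A x) * ρ * (Matrix.vecMulVec v (A x)).conjTranspose =
        (A * ρ).trace • Matrix.vecMulVec v (star v) := by
    intro A v hA hAA hv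
    have hA' : ∀ i j, (starRingEnd ℂ) (A i j) = A j i := fun i j => congrFun₂ hA j i
    refine ⟨?_, fun ρ => ?_⟩
    · simp_rw [Matrix.conjTranspose_vecMulVec, Matrix.vecMulVec_mul_vecMulVec, hv, one_smul]
      conv_rhs => rw [← hAA]
      ext i j
      simp [hA', Matrix.sum_apply, Matrix.mul_apply, Matrix.vecMulVec_apply]
    · have h1 : ∀ x, Matrix.vecMulVec v (A x) * ρ * (Matrix.vecMulVec v (A x)).conjTranspose =
          (A * ρ * A) x x • Matrix.vecMulVec v (star v) := by
        intro x
        rw [Matrix.conjTranspose_vecMulVec, Matrix.vecMulVec_mul, Matrix.vecMulVec_mul_vecMulVec,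
          Matrix.vecMulVec_smul]
        congr 1
        simp [hA', Matrix.mul_apply, Matrix.vecMul, dotProduct]
      simp_rw [h1]
      rw [← Finset.sum_smul]
      congr 1
      change (A * ρ * A).trace = _
      rw [Matrix.trace_mul_comm, ← mul_assoc, hAA]
  obtain ⟨k0, k0'⟩ := key _ (φ 0) hP hPP (hφ 0)
  obtain ⟨k1, k1'⟩ := key _ (φ 1) hQ hQQ (hφ 1)
  obtain ⟨C, hC⟩ := exists_channel
    (Sum.elim (fun x => Matrix.vecMulVec (φ 0) ((1 - Q) x)) fun x => Matrix.vecMulVec (φ 1) (Q x))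
    (by simp only [Fintype.sum_sum_type, Sum.elim_inl, Sum.elim_inr]; rw [k0, k1]; simp)
  refine ⟨C, fun ρ => ?_⟩
  rw [hC]
  simp only [Fintype.sum_sum_type, Sum.elim_inl, Sum.elim_inr]
  rw [k0', k1']

end Projection

/-! ## Lower bounds -/

/-- The projection on the vector `χ`, whose squared norm is `s`. -/
noncomputable def vectorProjection {n : Type} (χ : n → ℂ) (s : ℝ) : Matrix n n ℂ :=
  ((s⁻¹ : ℝ) : ℂ) • Matrix.vecMulVec χ (star χ)

theorem vectorProjection_conjTranspose {n : Type} (χ : n → ℂ) (s : ℝ) :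
    (vectorProjection χ s).conjTranspose = vectorProjection χ s := by
  rw [vectorProjection, Matrix.conjTranspose_smul, Matrix.conjTranspose_vecMulVec, star_star,
    RCLike.star_def, Complex.conj_ofReal]

theorem vectorProjection_mul_self {n : Type} [Fintype n] {χ : n → ℂ} {s : ℝ} (hs : s ≠ 0)
    (hχ : star χ ⬝ᵥ χ = (s : ℂ)) :
    vectorProjection χ s * vectorProjection χ s = vectorProjection χ s := by
  rw [vectorProjection, Matrix.smul_mul, Matrix.mul_smul, Matrix.vecMulVec_mul_vecMulVec, hχ,
    Matrix.vecMulVec_smul, smul_smul, smul_smul]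
  congr 1
  rw [← Complex.ofReal_mul, ← Complex.ofReal_mul]
  field_simp

section LowerBound

variable {d N a : ℕ} (l₁ : Fin d → ℝ) (l : Fin N → Fin d → ℝ) (γ : Fin N → ℝ)

theorem star_dotProduct_jump {p r : Fin d → ℝ} {ψ : Fin d × Fin a → ℂ}
    (hψ : ∀ α, ∑ β, ‖ψ (α, β)‖ ^ 2 = p α) :
    star (fun x : Fin d × Fin a => (r x.1 : ℂ) * ψ x) ⬝ᵥ (fun x => (r x.1 : ℂ) * ψ x) =
      ((∑ α, p α * r α ^ 2 : ℝ) : ℂ) := by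
  have h : ∀ x : Fin d × Fin a, star ((r x.1 : ℂ) * ψ x) * ((r x.1 : ℂ) * ψ x) =
      ((r x.1 ^ 2 * ‖ψ x‖ ^ 2 : ℝ) : ℂ) := by
    intro x
    rw [RCLike.star_def, ← Complex.normSq_eq_conj_mul_self, Complex.normSq_eq_norm_sq, norm_mul,
      mul_pow, Complex.norm_real, Real.norm_eq_abs, sq_abs]
  simp only [dotProduct, Pi.star_apply, h]
  rw [← Complex.ofReal_sum, Fintype.sum_prod_type]
  simp only [← Finset.mul_sum, hψ]
  congr 1
  exact Finset.sum_congr rfl fun _ _ => mul_comm _ _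

theorem trace_vectorProjection_mul_evolve {p r : Fin d → ℝ} {ψ : Fin d × Fin a → ℂ}
    (hψ : ∀ α, ∑ β, ‖ψ (α, β)‖ ^ 2 = p α) (s t θ : ℝ) :
    (vectorProjection (fun x : Fin d × Fin a => (r x.1 : ℂ) * ψ x) s *
      extendedEvolve a (diagOp l₁) (fun k => diagOp (l k)) (θ ^ 2) γ t
        (Matrix.vecMulVec ψ (star ψ))).trace =
      (jumpProb l₁ l γ (fun α => p α * r α) s t θ : ℂ) := by
  have h : ∀ x y : Fin d × Fin a, (r x.1 : ℂ) * ψ x * star ((r y.1 : ℂ) * ψ y) *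
      ((Real.exp (-(t * decayRate l₁ l (θ ^ 2) γ y.1 x.1)) : ℂ) * (ψ y * star (ψ x))) =
      ((r x.1 * r y.1 * Real.exp (-(t * decayRate l₁ l (θ ^ 2) γ x.1 y.1)) *
        (‖ψ x‖ ^ 2 * ‖ψ y‖ ^ 2) : ℝ) : ℂ) := by
    intro x y
    have e : decayRate l₁ l (θ ^ 2) γ y.1 x.1 = decayRate l₁ l (θ ^ 2) γ x.1 y.1 := by
      simp only [decayRate, sub_sq_comm]
    rw [e, ← Complex.normSq_eq_norm_sq, ← Complex.normSq_eq_norm_sq]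
    push_cast
    rw [Complex.normSq_eq_conj_mul_self, Complex.normSq_eq_conj_mul_self]
    simp only [star_mul', RCLike.star_def, Complex.conj_ofReal]
    ring
  rw [vectorProjection, Matrix.smul_mul, Matrix.trace_smul, Matrix.trace]
  simp only [Matrix.diag, Matrix.mul_apply, extendedEvolve_apply, Matrix.vecMulVec_apply,
    Pi.star_apply, h]
  simp only [← Complex.ofReal_sum, smul_eq_mul, ← Complex.ofReal_mul]
  congr 1
  rw [jumpProb, div_eq_inv_mul]
  congr 1
  simp only [Fintype.sum_prod_type]
  refine Finset.sum_congr rfl fun α _ => ?_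
  rw [Finset.sum_comm]
  refine Finset.sum_congr rfl fun α' _ => ?_
  simp only [← Finset.mul_sum, ← Finset.sum_mul, hψ]
  ring

variable {l₁ l} {p r : Fin d → ℝ} {s : ℝ}

theorem le_measureResetQFI {ψ : Fin d × Fin a → ℂ} (hψ : ∀ α, ∑ β, ‖ψ (α, β)‖ ^ 2 = p α)
    (hs : 0 < s) (hpr : ∑ α, p α * r α ^ 2 = s) {T : ℝ} {M : ℕ} {θ : ℝ} :
    ENNReal.ofReal ((M * jumpProbDeriv l₁ l γ (fun α => p α * r α) s (T / M) θ) ^ 2 /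
      (M * jumpProb l₁ l γ (fun α => p α * r α) s (T / M) θ)) ≤
      measureResetQFI (diagOp l₁) (fun k => diagOp (l k)) γ T ψ M θ := by
  have h1 := le_quantumFisher (vectorProjection_conjTranspose _ _)
    (vectorProjection_mul_self hs.ne' ((star_dotProduct_jump hψ).trans (by rw [hpr])))
    (fun θ' => trace_vectorProjection_mul_evolve l₁ l γ (r := r) hψ s (T / M) θ')
    (hasDerivAt_jumpProb l₁ l γ _ s (T / M) θ)
  refine le_trans (le_of_eq ?_) (mul_le_mul_right h1 (M : ℝ≥0∞))
  rw [← ENNReal.ofReal_natCast, ← ENNReal.ofReal_mul (Nat.cast_nonneg _)]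
  congr 1
  rcases eq_or_ne (M : ℝ) 0 with h0 | h0
  · simp [h0]
  · field_simp

end LowerBound

/-! ## A sequential strategy with a flag ancilla -/

section FlagStrategy

variable {d N : ℕ}

/-- The state with real amplitudes `√p` of the system and the flag `b` of a two-level ancilla. -/
noncomputable def flagState (p : Fin d → ℝ) (b : Fin 2) (x : Fin d × Fin 2) : ℂ :=
  if x.2 = b then (√(p x.1) : ℂ) else 0

/-- The event that the flag is raised or a signal jump is detected. -/
noncomputable def flagProjection (p r : Fin d → ℝ) (s : ℝ) :
    Matrix (Fin d × Fin 2) (Fin d × Fin 2) ℂ :=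
  vectorProjection (fun x => (r x.1 : ℂ) * flagState p 0 x) s +
    Matrix.diagonal fun x => if x.2 = 1 then 1 else 0

variable {p r : Fin d → ℝ} {s : ℝ}

theorem flagState_population (hp : ∀ α, 0 ≤ p α) (b : Fin 2) (α : Fin d) :
    ∑ β, ‖flagState p b (α, β)‖ ^ 2 = p α := by
  rw [Finset.sum_eq_single b]
  · simp [flagState, Real.sq_sqrt (hp α)]
  · intro β _ hβ
    simp [flagState, hβ]
  · simp

theorem star_dotProduct_flagState (hp : p ∈ stdSimplex ℝ (Fin d)) (b : Fin 2) :
    star (flagState p b) ⬝ᵥ flagState p b = 1 := by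
  have h := star_dotProduct_jump (r := fun _ => 1) (flagState_population hp.1 b)
  simpa [hp.2] using h

theorem flagProjection_conjTranspose : (flagProjection p r s).conjTranspose = flagProjection p r s := by
  rw [flagProjection, Matrix.conjTranspose_add, vectorProjection_conjTranspose,
    Matrix.diagonal_conjTranspose]
  congr 2
  ext x
  by_cases h : x.2 = 1 <;> simp [h]

/-- The jump vector has flag `0`, so the two summands are orthogonal projections. -/
theorem flagProjection_mul_self (hp : ∀ α, 0 ≤ p α) (hs : 0 < s) (hpr : ∑ α, p α * r α ^ 2 = s) :
    flagProjection p r s * flagProjection p r s = flagProjection p r s := by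
  have h1 := vectorProjection_mul_self hs.ne'
    ((star_dotProduct_jump (r := r) (flagState_population hp 0)).trans (by rw [hpr]))
  rw [flagProjection, add_mul, mul_add, mul_add, h1, Matrix.diagonal_mul_diagonal]
  have h2 : vectorProjection (fun x => (r x.1 : ℂ) * flagState p 0 x) s *
      Matrix.diagonal (fun x => if x.2 = 1 then 1 else 0) = 0 := by
    ext x y
    by_cases h : y.2 = 1 <;> simp [vectorProjection, Matrix.vecMulVec_apply, flagState, h]
  have h3 : Matrix.diagonal (fun x => if x.2 = 1 then 1 else 0) *
      vectorProjection (fun x => (r x.1 : ℂ) * flagState p 0 x) s = 0 := by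
    ext x y
    by_cases h : x.2 = 1 <;> simp [vectorProjection, Matrix.vecMulVec_apply, flagState, h]
  rw [h2, h3, add_zero, zero_add]
  congr 2
  ext x
  by_cases h : x.2 = 1 <;> simp [h]

variable (l₁ : Fin d → ℝ) (l : Fin N → Fin d → ℝ) (γ : Fin N → ℝ)

theorem trace_flagProjection_zero (hp : ∀ α, 0 ≤ p α) (t θ : ℝ) :
    (flagProjection p r s * extendedEvolve 2 (diagOp l₁) (fun k => diagOp (l k)) (θ ^ 2) γ t
      (Matrix.vecMulVec (flagState p 0) (star (flagState p 0)))).trace =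
      (jumpProb l₁ l γ (fun α => p α * r α) s t θ : ℂ) := by
  rw [flagProjection, add_mul, Matrix.trace_add,
    trace_vectorProjection_mul_evolve l₁ l γ (flagState_population hp 0)]
  convert add_zero _
  refine Finset.sum_eq_zero fun x _ => ?_
  by_cases h : x.2 = 1 <;>
  simp [h, Matrix.diagonal_mul, extendedEvolve_apply, Matrix.vecMulVec_apply, flagState]

theorem trace_flagProjection_one (hp : p ∈ stdSimplex ℝ (Fin d)) (t γ₁ : ℝ) :
    (flagProjection p r s * extendedEvolve 2 (diagOp l₁) (fun k => diagOp (l k)) γ₁ γ t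
      (Matrix.vecMulVec (flagState p 1) (star (flagState p 1)))).trace = 1 := by
  rw [flagProjection, add_mul, Matrix.trace_add]
  have h1 : (vectorProjection (fun x => (r x.1 : ℂ) * flagState p 0 x) s *
      extendedEvolve 2 (diagOp l₁) (fun k => diagOp (l k)) γ₁ γ t
      (Matrix.vecMulVec (flagState p 1) (star (flagState p 1)))).trace = 0 := by
    refine Finset.sum_eq_zero fun x _ => ?_
    rw [Matrix.diag, Matrix.mul_apply]
    refine Finset.sum_eq_zero fun y _ => ?_
    by_cases h : y.2 = 1 <;>
    simp [vectorProjection, extendedEvolve_apply, Matrix.vecMulVec_apply, flagState, h]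
  have h2 : ((Matrix.diagonal fun x : Fin d × Fin 2 => if x.2 = 1 then (1 : ℂ) else 0) *
      extendedEvolve 2 (diagOp l₁) (fun k => diagOp (l k)) γ₁ γ t
      (Matrix.vecMulVec (flagState p 1) (star (flagState p 1)))).trace =
      (extendedEvolve 2 (diagOp l₁) (fun k => diagOp (l k)) γ₁ γ t
      (Matrix.vecMulVec (flagState p 1) (star (flagState p 1)))).trace := by
    refine Finset.sum_congr rfl fun x _ => ?_
    by_cases h : x.2 = 1 <;>
    simp [h, Matrix.diagonal_mul, extendedEvolve_apply, Matrix.vecMulVec_apply, flagState]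
  rw [h1, h2, trace_extendedEvolve, Matrix.trace_vecMulVec, dotProduct_comm,
    star_dotProduct_flagState hp, zero_add]

theorem extendedEvolve_combination {a : ℕ} (γ₁ t : ℝ) (u v : ℂ)
    (ρ σ : Matrix (Fin d × Fin a) (Fin d × Fin a) ℂ) :
    extendedEvolve a (diagOp l₁) (fun k => diagOp (l k)) γ₁ γ t (u • ρ + v • σ) =
      u • extendedEvolve a (diagOp l₁) (fun k => diagOp (l k)) γ₁ γ t ρ +
      v • extendedEvolve a (diagOp l₁) (fun k => diagOp (l k)) γ₁ γ t σ := by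
  ext x y
  simp only [extendedEvolve_apply, Matrix.add_apply, Matrix.smul_apply, smul_eq_mul]
  ring

theorem extendedEvolve_zero {a : ℕ} (γ₁ : ℝ) (ρ : Matrix (Fin d × Fin a) (Fin d × Fin a) ℂ) :
    extendedEvolve a (diagOp l₁) (fun k => diagOp (l k)) γ₁ γ 0 ρ = ρ := by
  ext x y
  simp [extendedEvolve_apply]

/-- Preparing `flagState p 0` after each round and raising the flag at the first detected jump. -/
theorem sequentialState_flag (hp : p ∈ stdSimplex ℝ (Fin d)) {t : ℝ}
    {C : QuantumChannel (Fin d × Fin 2)}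
    (hC : ∀ ρ, C.apply ρ =
      ((1 - flagProjection p r s) * ρ).trace •
        Matrix.vecMulVec (flagState p 0) (star (flagState p 0)) +
      (flagProjection p r s * ρ).trace •
        Matrix.vecMulVec (flagState p 1) (star (flagState p 1))) (θ : ℝ) (k : ℕ) :
    let f := jumpProb l₁ l γ (fun α => p α * r α) s t θ
    sequentialState 2 (diagOp l₁) (fun k => diagOp (l k)) (θ ^ 2) γ t (fun _ => C)
      (Matrix.vecMulVec (flagState p 0) (star (flagState p 0))) k =
      (((1 - f) ^ k : ℝ) : ℂ) • Matrix.vecMulVec (flagState p 0) (star (flagState p 0)) +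
      ((1 - (1 - f) ^ k : ℝ) : ℂ) • Matrix.vecMulVec (flagState p 1) (star (flagState p 1)) := by
  intro f
  have hnorm : ∀ b, (Matrix.vecMulVec (flagState p b) (star (flagState p b))).trace = 1 := by
    intro b
    rw [Matrix.trace_vecMulVec, dotProduct_comm, star_dotProduct_flagState hp]
  induction k with
  | zero => simp [sequentialState]
  | succ k ih =>
    have h : ∀ ρ, ((1 - flagProjection p r s) * ρ).trace =
        ρ.trace - (flagProjection p r s * ρ).trace := fun ρ => by
      rw [sub_mul, one_mul, Matrix.trace_sub]
    rw [sequentialState, ih, hC, h, trace_extendedEvolve, extendedEvolve_combination, mul_add,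
      Matrix.trace_add, Matrix.trace_add, Matrix.mul_smul, Matrix.mul_smul, Matrix.trace_smul,
      Matrix.trace_smul, Matrix.trace_smul, Matrix.trace_smul, trace_flagProjection_zero _ _ _ hp.1,
      trace_flagProjection_one _ _ _ hp, hnorm, hnorm]
    congr 2
    · push_cast [smul_eq_mul]
      ring
    · push_cast [smul_eq_mul]
      ring

/-- The flag is raised with probability `1 - (1 - f) ^ M`, where `f` is the jump probability of one
round; the bound is the Fisher contribution of this one outcome. -/
theorem le_sequentialQFI (hp : p ∈ stdSimplex ℝ (Fin d)) (hq : ∑ α, p α * r α = 0) (hs : 0 < s)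
    (hpr : ∑ α, p α * r α ^ 2 = s) {T : ℝ} {M : ℕ} {θ : ℝ} :
    ENNReal.ofReal
      ((M * (1 - jumpProb l₁ l γ (fun α => p α * r α) s (T / M) θ) ^ (M - 1) *
        jumpProbDeriv l₁ l γ (fun α => p α * r α) s (T / M) θ) ^ 2 /
      (1 - (1 - jumpProb l₁ l γ (fun α => p α * r α) s (T / M) θ) ^ M)) ≤
      sequentialQFI (diagOp l₁) (fun k => diagOp (l k)) γ T M θ := by
  have hQ : (flagProjection p r s).conjTranspose = _ := flagProjection_conjTranspose
  have hQQ := flagProjection_mul_self hp.1 hs hpr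
  obtain ⟨C, hC⟩ := exists_measure_prepare_channel hQ hQQ (flagState p)
    (star_dotProduct_flagState hp)
  refine le_iSup_of_le 2 (le_iSup_of_le
    ⟨Matrix.vecMulVec (flagState p 0) (star (flagState p 0)),
      Matrix.posSemidef_vecMulVec_self_star _, ?_⟩ (le_iSup_of_le (fun _ => C) ?_))
  · rw [Matrix.trace_vecMulVec, dotProduct_comm, star_dotProduct_flagState hp]
  refine le_quantumFisher hQ hQQ
    (f := fun θ => 1 - (1 - jumpProb l₁ l γ (fun α => p α * r α) s (T / M) θ) ^ M) (fun θ' => ?_)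
    (((((hasDerivAt_jumpProb l₁ l γ (fun α => p α * r α) s (T / M) θ).const_sub 1).fun_pow
      M).const_sub 1).congr_deriv (by ring))
  -- Time zero gives the response of the final measurement to the two prepared states: none without
  -- the flag, certain with it.
  have h0 := trace_flagProjection_zero (r := r) (s := s) l₁ l γ hp.1 0 θ'
  have h1 := trace_flagProjection_one (r := r) (s := s) l₁ l γ hp 0 (θ' ^ 2)
  rw [extendedEvolve_zero] at h0 h1
  rw [jumpProb_zero γ hq] at h0
  rw [sequentialState_flag l₁ l γ hp hC, mul_add, Matrix.trace_add, Matrix.mul_smul,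
    Matrix.mul_smul, Matrix.trace_smul, Matrix.trace_smul, h0, h1]
  simp

/-- Recording only the first jump loses a factor of at least `(1 - M f)²` by Bernoulli's inequality;
`M f` tends to `T θ² s`, which vanishes with `θ`. -/
theorem eventually_le_sequentialQFI (hp : p ∈ stdSimplex ℝ (Fin d)) (hq : ∑ α, p α * r α = 0)
    (hql : ∀ k, ∑ α, p α * r α * l k α = 0) (hql₁ : ∑ α, p α * r α * l₁ α = s) (hs : 0 < s)
    (hpr : ∑ α, p α * r α ^ 2 = s) {T : ℝ} (hT : 0 < T) {u : ℝ} (hu : u < 4 * T * s) :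
    ∀ᶠ θ in 𝓝[>] (0 : ℝ), ∀ᶠ M : ℕ in atTop,
      ENNReal.ofReal u ≤ sequentialQFI (diagOp l₁) (fun k => diagOp (l k)) γ T M θ := by
  have hc : ContinuousAt (fun θ : ℝ => (1 - T * (θ ^ 2 * s)) ^ 2 * (4 * T * s)) 0 := by fun_prop
  have hc' : ContinuousAt (fun θ : ℝ => T * (θ ^ 2 * s)) 0 := by fun_prop
  have e1 : ∀ᶠ θ in 𝓝[>] (0 : ℝ), u < (1 - T * (θ ^ 2 * s)) ^ 2 * (4 * T * s) :=
    (hc.eventually_const_lt (by simpa using hu)).filter_mono nhdsWithin_le_nhds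
  have e2 : ∀ᶠ θ in 𝓝[>] (0 : ℝ), T * (θ ^ 2 * s) < 1 :=
    (hc'.eventually_lt_const (by simp)).filter_mono nhdsWithin_le_nhds
  filter_upwards [e1, e2, self_mem_nhdsWithin] with θ h1 h2 h3
  have hθ : 0 < θ := h3
  have t1 := tendsto_mul_jumpProb (s := s) γ hq hql hql₁ hs hT θ
  have t2 := ((t1.const_sub 1).pow 2).mul (tendsto_mul_jumpProb_fisher γ hq hql hql₁ hs hT hθ)
  filter_upwards [t2.eventually_const_lt h1, t1.eventually_lt_const h2,
    t1.eventually_const_lt (show 0 < T * (θ ^ 2 * s) by positivity),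
    eventually_gt_atTop 0] with M m1 m2 m3 m4
  refine le_trans (ENNReal.ofReal_le_ofReal ?_) (le_sequentialQFI l₁ l γ hp hq hs hpr)
  generalize jumpProb l₁ l γ (fun α => p α * r α) s (T / M) θ = f at *
  generalize jumpProbDeriv l₁ l γ (fun α => p α * r α) s (T / M) θ = f' at *
  have hM : (1 : ℝ) ≤ M := by exact_mod_cast m4
  have hf0 : 0 < f := by
    by_contra! h
    nlinarith
  have hf1 : f < 1 := by nlinarith
  have b1 : 1 - M * f ≤ (1 - f) ^ (M - 1) := by
    have h := one_add_mul_le_pow (show -2 ≤ -f by linarith) (M - 1)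
    rw [Nat.cast_sub m4, Nat.cast_one] at h
    rw [← sub_eq_add_neg] at h
    linarith
  have b2 : 1 - (1 - f) ^ M ≤ M * f := by
    have h := one_add_mul_le_pow (show -2 ≤ -f by linarith) M
    rw [← sub_eq_add_neg] at h
    linarith
  have b3 : 0 < 1 - (1 - f) ^ M := by
    have := pow_lt_one₀ (show 0 ≤ 1 - f by linarith) (by linarith) m4.ne'
    linarith
  calc u ≤ (1 - M * f) ^ 2 * ((M * f') ^ 2 / (M * f)) := m1.le
    _ = ((1 - M * f) ^ 2 * (M * f') ^ 2) / (M * f) := by rw [mul_div_assoc]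
    _ ≤ (((1 - f) ^ (M - 1)) ^ 2 * (M * f') ^ 2) / (1 - (1 - f) ^ M) := by
        have : (1 - M * f) ^ 2 ≤ ((1 - f) ^ (M - 1)) ^ 2 :=
          pow_le_pow_left₀ (by linarith) b1 2
        gcongr
    _ = _ := by ring

end FlagStrategy

/-! ## Limits -/

/-- Needed for uniqueness of the iterated limit. -/
instance curry_neBot {α β : Type} (f : Filter α) (g : Filter β) [f.NeBot] [g.NeBot] :
    (f.curry g).NeBot := by
  rw [neBot_iff, ne_eq, ← eventually_false_iff_eq_bot, eventually_curry_iff]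
  simp [NeBot.ne]

theorem hasFastVanishingLimit_unique {F : ℕ → ℝ → ℝ≥0∞} {v w : ℝ≥0∞}
    (hv : HasFastVanishingLimit F v) (hw : HasFastVanishingLimit F w) : v = w :=
  tendsto_nhds_unique hv hw

theorem HasFastVanishingLimit.of_bounds {F : ℕ → ℝ → ℝ≥0∞} {v : ℝ} (hv : 0 < v)
    (hl : ∀ u < v, ∀ᶠ θ in 𝓝[>] (0 : ℝ), ∀ᶠ M in atTop, ENNReal.ofReal u ≤ F M θ)
    (hu : ∀ u > v, ∀ᶠ θ in 𝓝[>] (0 : ℝ), ∀ᶠ M in atTop, F M θ ≤ ENNReal.ofReal u) :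
    HasFastVanishingLimit F (ENNReal.ofReal v) := by
  refine tendsto_order.2 ⟨fun u hu' => ?_, fun u hu' => ?_⟩
  · lift u to NNReal using (hu'.trans ENNReal.ofReal_lt_top).ne
    have h1 : (u : ℝ) < v := by
      rw [← ENNReal.ofReal_coe_nnreal, ENNReal.ofReal_lt_ofReal_iff hv] at hu'
      exact hu'
    obtain ⟨w, hw1, hw2⟩ := exists_between h1
    rw [eventually_curry_iff]
    filter_upwards [hl w hw2] with θ hθ
    filter_upwards [hθ] with M hM
    refine lt_of_lt_of_le ?_ hM
    rw [← ENNReal.ofReal_coe_nnreal, ENNReal.ofReal_lt_ofReal_iff (u.2.trans_lt hw1)]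
    exact hw1
  · obtain ⟨w, hw1, hw2⟩ := exists_between hu'
    lift w to NNReal using (hw2.trans_le le_top).ne
    have h1 : v < (w : ℝ) := by
      rw [← ENNReal.ofReal_coe_nnreal (p := w), ENNReal.ofReal_lt_ofReal_iff_of_nonneg hv.le] at hw1
      exact hw1
    rw [eventually_curry_iff]
    filter_upwards [hu w h1] with θ hθ
    filter_upwards [hθ] with M hM
    rw [ENNReal.ofReal_coe_nnreal] at hM
    exact hM.trans_lt hw2

theorem HasFastVanishingLimit.le_of_eventually_le {F : ℕ → ℝ → ℝ≥0∞} {v w : ℝ≥0∞}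
    (hv : HasFastVanishingLimit F v)
    (hu : ∀ᶠ θ in 𝓝[>] (0 : ℝ), ∀ᶠ M in atTop, F M θ ≤ w) : v ≤ w :=
  le_of_tendsto hv (eventually_curry_iff.2 hu)

section Limits

variable {d N : ℕ} {l₁ : Fin d → ℝ} {l : Fin N → Fin d → ℝ} {γ : Fin N → ℝ} {T : ℝ}

theorem eventually_sequentialQFI_le (hγ : ∀ k, 0 < γ k) (hT : 0 < T) {c₀ b u : ℝ} {c : Fin N → ℝ}
    (hb : ∀ α, noiseResidual l₁ l c₀ c α ^ 2 ≤ b) (hu : 4 * T * b < u) :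
    ∀ᶠ θ in 𝓝[>] (0 : ℝ), ∀ᶠ M : ℕ in atTop,
      sequentialQFI (diagOp l₁) (fun k => diagOp (l k)) γ T M θ ≤ ENNReal.ofReal u := by
  have hb' : b < u / (4 * T) := by
    rw [lt_div_iff₀ (by positivity)]
    linarith
  have h : ∀ᶠ θ in 𝓝[>] (0 : ℝ), ∀ α, noiseResidual l₁ l c₀ c α ^ 2 +
      (∑ k, c k ^ 2 / γ k) * (θ * l₁ α) ^ 2 < u / (4 * T) := by
    refine eventually_all.2 fun α => Eventually.filter_mono nhdsWithin_le_nhds ?_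
    have hc : ContinuousAt (fun θ : ℝ => noiseResidual l₁ l c₀ c α ^ 2 +
      (∑ k, c k ^ 2 / γ k) * (θ * l₁ α) ^ 2) 0 := by fun_prop
    exact hc.eventually_lt_const (by simpa using (hb α).trans_lt hb')
  filter_upwards [h] with θ hθ
  filter_upwards [eventually_gt_atTop 0] with M hM
  refine (sequentialQFI_le l₁ l hγ hT θ c₀ c hθ hM).trans (le_of_eq ?_)
  congr 1
  field_simp

theorem eventually_measureResetQFI_le (hγ : ∀ k, 0 < γ k) (hT : 0 < T) {c₀ u : ℝ} {c : Fin N → ℝ}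
    {a : ℕ} {p : Fin d → ℝ} {ψ : Fin d × Fin a → ℂ} (hp : ∑ α, p α = 1)
    (hψ : ∀ α, ∑ β, ‖ψ (α, β)‖ ^ 2 = p α)
    (hu : 4 * T * ∑ α, p α * noiseResidual l₁ l c₀ c α ^ 2 < u) :
    ∀ᶠ θ in 𝓝[>] (0 : ℝ), ∀ᶠ M : ℕ in atTop,
      measureResetQFI (diagOp l₁) (fun k => diagOp (l k)) γ T ψ M θ ≤ ENNReal.ofReal u := by
  have hb' : ∑ α, p α * noiseResidual l₁ l c₀ c α ^ 2 < u / (4 * T) := by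
    rw [lt_div_iff₀ (by positivity)]
    linarith
  have h : ∀ᶠ θ in 𝓝[>] (0 : ℝ), ∑ α, p α * (noiseResidual l₁ l c₀ c α ^ 2 +
      (∑ k, c k ^ 2 / γ k) * (θ * l₁ α) ^ 2) < u / (4 * T) := by
    refine Eventually.filter_mono nhdsWithin_le_nhds ?_
    have hc : ContinuousAt (fun θ : ℝ => ∑ α, p α * (noiseResidual l₁ l c₀ c α ^ 2 +
      (∑ k, c k ^ 2 / γ k) * (θ * l₁ α) ^ 2)) 0 := by fun_prop
    exact hc.eventually_lt_const (by simpa using hb')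
  filter_upwards [h] with θ hθ
  filter_upwards [eventually_gt_atTop 0] with M hM
  have hM' : (0 : ℝ) < M := by exact_mod_cast hM
  refine (mul_le_mul_right
    (quantumFisher_extendedEvolve_le l₁ l hγ (show 0 ≤ T / M by positivity) θ c₀ c hp hψ hθ)
    (M : ℝ≥0∞)).trans (le_of_eq ?_)
  rw [← ENNReal.ofReal_natCast, ← ENNReal.ofReal_mul (Nat.cast_nonneg _)]
  congr 1
  field_simp

theorem eventually_le_measureResetQFI {p r : Fin d → ℝ} {s : ℝ} (hq : ∑ α, p α * r α = 0)
    (hql : ∀ k, ∑ α, p α * r α * l k α = 0) (hql₁ : ∑ α, p α * r α * l₁ α = s) (hs : 0 < s)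
    (hpr : ∑ α, p α * r α ^ 2 = s) (hT : 0 < T) {u : ℝ} (hu : u < 4 * T * s)
    {a : ℕ} {ψ : Fin d × Fin a → ℂ} (hψ : ∀ α, ∑ β, ‖ψ (α, β)‖ ^ 2 = p α) :
    ∀ᶠ θ in 𝓝[>] (0 : ℝ), ∀ᶠ M : ℕ in atTop,
      ENNReal.ofReal u ≤ measureResetQFI (diagOp l₁) (fun k => diagOp (l k)) γ T ψ M θ := by
  filter_upwards [self_mem_nhdsWithin] with θ hθ
  filter_upwards [(tendsto_mul_jumpProb_fisher γ hq hql hql₁ hs hT hθ).eventually_const_lt hu]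
    with M hM
  exact (ENNReal.ofReal_le_ofReal hM.le).trans (le_measureResetQFI γ hψ hs hpr)

end Limits

/-! ## Minimal residuals and balanced distributions -/

/-- The optimality conditions for a distribution `p` relative to a minimal residual `a`. -/
structure IsBalanced {d N : ℕ} (l : Fin N → Fin d → ℝ) (a p : Fin d → ℝ) : Prop where
  mem_stdSimplex : p ∈ stdSimplex ℝ (Fin d)
  support : ∀ α, p α ≠ 0 → α ∈ maxIndices a
  sum_eq_zero : ∑ α, p α * a α = 0
  sum_noise_eq_zero : ∀ k, ∑ α, p α * a α * l k α = 0

section Residual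

variable {d N : ℕ} {l₁ : Fin d → ℝ} {l : Fin N → Fin d → ℝ} {a p : Fin d → ℝ}

theorem noiseResidual_eq (c₀ : ℝ) (c : Fin N → ℝ) :
    l₁ - c₀ • 1 - ∑ k, c k • l k = noiseResidual l₁ l c₀ c := by
  ext α
  simp [noiseResidual]

theorem isMinimalResidual_iff : IsMinimalResidual l₁ l a ↔
    (∃ c₀ c, a = noiseResidual l₁ l c₀ c) ∧ ∀ c₀ c, ‖a‖ ≤ ‖noiseResidual l₁ l c₀ c‖ := by
  simp only [IsMinimalResidual, noiseResidual_eq]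

/-- The span of `1` and the noises is finite-dimensional, hence closed, so the sup-distance of `l₁`
to it is attained. -/
theorem exists_isMinimalResidual (l₁ : Fin d → ℝ) (l : Fin N → Fin d → ℝ) :
    ∃ a, IsMinimalResidual l₁ l a := by
  set Φ : (ℝ × (Fin N → ℝ)) →ₗ[ℝ] (Fin d → ℝ) :=
    (LinearMap.toSpanSingleton ℝ (Fin d → ℝ) 1).coprod (Fintype.linearCombination ℝ l) with hΦ
  have h : ∀ c₀ c, l₁ - c₀ • 1 - ∑ k, c k • l k = l₁ - Φ (c₀, c) := by
    intro c₀ c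
    simp [hΦ, Fintype.linearCombination_apply, sub_sub]
  obtain ⟨v, ⟨⟨c₀, c⟩, rfl⟩, hv⟩ := (Submodule.closed_of_finiteDimensional
    (LinearMap.range Φ)).exists_infDist_eq_dist ⟨0, zero_mem _⟩ l₁
  refine ⟨l₁ - Φ (c₀, c), ⟨c₀, c, (h _ _).symm⟩, fun c₀' c' => ?_⟩
  rw [h, ← dist_eq_norm, ← dist_eq_norm, ← hv]
  exact Metric.infDist_le_dist_of_mem ⟨_, rfl⟩

theorem noiseResidual_sub {c₀ : ℝ} {c : Fin N → ℝ} (e₀ : ℝ) (e : Fin N → ℝ) (α : Fin d) :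
    noiseResidual l₁ l (c₀ + e₀) (c + e) α =
      noiseResidual l₁ l c₀ c α - (e₀ + ∑ k, e k * l k α) := by
  simp only [noiseResidual, Pi.add_apply, add_mul, Finset.sum_add_distrib]
  ring

theorem IsMinimalResidual.norm_pos (ha : IsMinimalResidual l₁ l a) (hl₁ : l₁ ≠ 0)
    (hsum₁ : ∑ α, l₁ α = 0) (horth₁ : ∀ k, ∑ α, l₁ α * l k α = 0) : 0 < ‖a‖ := by
  rw [norm_pos_iff]
  rintro rfl
  obtain ⟨⟨c₀, c, hc⟩, -⟩ := isMinimalResidual_iff.1 ha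
  refine hl₁ ?_
  have h1 : ∀ α, l₁ α = c₀ + ∑ k, c k * l k α := fun α => by
    have := congrFun hc α
    simp only [Pi.zero_apply, noiseResidual] at this
    linarith
  have h2 : ∑ α, l₁ α * l₁ α = 0 := by
    calc ∑ α, l₁ α * l₁ α = ∑ α, (c₀ * l₁ α + ∑ k, c k * (l₁ α * l k α)) := by
          refine Finset.sum_congr rfl fun α _ => ?_
          nth_rewrite 2 [h1 α]
          rw [mul_add, Finset.mul_sum, mul_comm]
          congr 1
          exact Finset.sum_congr rfl fun k _ => by ring
      _ = 0 := by
          rw [Finset.sum_add_distrib, Finset.sum_comm]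
          simp [← Finset.mul_sum, hsum₁, horth₁]
  ext α
  have := (Finset.sum_eq_zero_iff_of_nonneg fun α _ => mul_self_nonneg (l₁ α)).1 h2 α
    (Finset.mem_univ α)
  simpa using this

/-- Were there none, the image under the balance functionals of the simplex face over the maximal
indices would miss zero. A separating hyperplane is a combination `v` of `1` and the noises with `a
v > 0` at all maximal indices, and subtracting a small multiple of `v` lowers the norm of `a`. -/
theorem exists_isBalanced (ha : IsMinimalResidual l₁ l a) (hpos : 0 < ‖a‖) :
    ∃ p, IsBalanced l a p := by
  by_contra! hno
  set G : (Fin d → ℝ) →ₗ[ℝ] (Option (Fin N) → ℝ) :=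
    LinearMap.pi fun o => Fintype.linearCombination ℝ fun α => a α * o.elim 1 (fun k => l k α)
    with hG
  have hGa : ∀ p o, G p o = ∑ α, p α * (a α * o.elim 1 (fun k => l k α)) := by
    intro p o
    simp [hG, Fintype.linearCombination_apply]
  set K : Set (Fin d → ℝ) := stdSimplex ℝ (Fin d) ∩ {p | ∀ α, α ∉ maxIndices a → p α = 0} with hK
  have hKc : IsCompact K := by
    refine (isCompact_stdSimplex ℝ (Fin d)).inter_right ?_
    simp only [Set.ofPred_forall]
    exact isClosed_iInter fun α => isClosed_iInter fun _ =>
      isClosed_eq (continuous_apply α) continuous_const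
  have hKv : Convex ℝ K := by
    refine (convex_stdSimplex ℝ (Fin d)).inter fun x hx y hy u v _ _ _ α hα => ?_
    simp [hx α hα, hy α hα]
  have h0 : (0 : Option (Fin N) → ℝ) ∉ G '' K := by
    rintro ⟨p, ⟨hp, hp'⟩, hGp⟩
    refine hno p ⟨hp, fun α hα => by_contra fun h => hα (hp' α h), ?_, fun k => ?_⟩
    · have h := congrFun hGp none
      rw [hGa] at h
      simpa using h
    · have h := congrFun hGp (some k)
      rw [hGa] at h
      simpa [mul_assoc] using h
  obtain ⟨f, u, hu, hf⟩ := geometric_hahn_banach_point_closed (hKv.linear_image G)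
    ((hKc.image G.continuous_of_finiteDimensional).isClosed) h0
  rw [map_zero] at hu
  set e₀ : ℝ := f (Pi.single none 1) with he₀
  set e : Fin N → ℝ := fun k => f (Pi.single (some k) 1) with he
  have hfx : ∀ x : Option (Fin N) → ℝ, f x = x none * e₀ + ∑ k, x (some k) * e k := by
    intro x
    conv_lhs => rw [pi_eq_sum_univ' x]
    rw [map_sum, Fintype.sum_option]
    simp only [map_smul, smul_eq_mul, he₀, he]
  have hv : ∀ α ∈ maxIndices a, 0 < a α * (e₀ + ∑ k, e k * l k α) := by
    intro α hα
    have h1 : Pi.single α 1 ∈ K := by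
      refine ⟨single_mem_stdSimplex ℝ α, fun β hβ => ?_⟩
      rw [Pi.single_apply, if_neg]
      rintro rfl
      exact hβ hα
    have h2 := hu.trans (hf _ ⟨_, h1, rfl⟩)
    rw [hfx] at h2
    simp only [hGa, Pi.single_apply, ite_mul, one_mul, zero_mul, Finset.sum_ite_eq', Finset.mem_univ,
      if_true, Option.elim] at h2
    refine h2.trans_eq ?_
    rw [mul_add, mul_one, Finset.mul_sum]
    congr 1
    exact Finset.sum_congr rfl fun k _ => by ring
  obtain ⟨⟨c₀, c, hc⟩, hmin⟩ := isMinimalResidual_iff.1 ha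
  -- At maximal indices `(a - ε v)² = a² - ε (2 a v - ε v²)` drops for small `ε > 0`; at the others
  -- the strict inequality persists by continuity.
  have hev : ∀ᶠ ε in 𝓝[>] (0 : ℝ), ∀ α, |a α - ε * (e₀ + ∑ k, e k * l k α)| < ‖a‖ := by
    refine eventually_all.2 fun α => ?_
    set v := e₀ + ∑ k, e k * l k α with hvv
    by_cases hα : α ∈ maxIndices a
    · have h1 := hv α hα
      have h2 : ContinuousAt (fun ε : ℝ => ε * v ^ 2) 0 := by fun_prop
      filter_upwards [self_mem_nhdsWithin, (h2.eventually_lt_const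
        (show (0 : ℝ) * v ^ 2 < 2 * (a α * v) by simpa using h1)).filter_mono nhdsWithin_le_nhds]
        with ε hε hε'
      have hε : 0 < ε := hε
      rw [← (Finset.mem_filter.1 hα).2]
      refine sq_lt_sq.1 ?_
      nlinarith
    · have h1 : |a α| < ‖a‖ := lt_of_le_of_ne (norm_le_pi_norm a α) fun h =>
        hα (Finset.mem_filter.2 ⟨Finset.mem_univ _, h⟩)
      have h2 : ContinuousAt (fun ε : ℝ => |a α - ε * v|) 0 := by fun_prop
      exact (h2.eventually_lt_const (by simpa using h1)).filter_mono nhdsWithin_le_nhds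
  obtain ⟨ε, hε⟩ := hev.exists
  refine absurd (hmin (c₀ + ε * e₀) (c + ε • e)) (not_le.2 ?_)
  rw [pi_norm_lt_iff hpos]
  intro α
  rw [noiseResidual_sub, ← hc, Real.norm_eq_abs]
  convert hε α using 3
  simp [mul_add, Finset.mul_sum, mul_assoc]

namespace IsBalanced

theorem mul_abs_eq (h : IsBalanced l a p) (α : Fin d) : p α * |a α| = p α * ‖a‖ := by
  by_cases h0 : p α = 0
  · simp [h0]
  · rw [(Finset.mem_filter.1 (h.support α h0)).2]

theorem sum_sq (h : IsBalanced l a p) : ∑ α, p α * a α ^ 2 = ‖a‖ ^ 2 := by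
  have h1 : ∀ α, p α * a α ^ 2 = p α * ‖a‖ ^ 2 := fun α => by
    rw [← sq_abs, sq, ← mul_assoc, h.mul_abs_eq, mul_right_comm, h.mul_abs_eq]
    ring
  simp only [h1, ← Finset.sum_mul, h.mem_stdSimplex.2, one_mul]

theorem sum_combination (h : IsBalanced l a p) (e₀ : ℝ) (e : Fin N → ℝ) :
    ∑ α, p α * a α * (e₀ + ∑ k, e k * l k α) = 0 := by
  simp only [mul_add, Finset.sum_add_distrib, ← Finset.sum_mul, h.sum_eq_zero, Finset.mul_sum]
  rw [Finset.sum_comm]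
  simp only [mul_left_comm _ (e _), ← Finset.mul_sum, h.sum_noise_eq_zero]
  simp

/-- `l₁ - a` is a combination of `1` and the noises, to which `p a` is orthogonal. -/
theorem sum_signal (h : IsBalanced l a p) (ha : IsMinimalResidual l₁ l a) :
    ∑ α, p α * a α * l₁ α = ‖a‖ ^ 2 := by
  obtain ⟨⟨c₀, c, hc⟩, -⟩ := isMinimalResidual_iff.1 ha
  have h1 : ∀ α, l₁ α = a α + (c₀ + ∑ k, c k * l k α) := fun α => by
    rw [hc, noiseResidual]
    ring
  rw [← h.sum_sq, Finset.sum_congr rfl fun α _ => by rw [h1 α, mul_add], Finset.sum_add_distrib,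
    h.sum_combination, add_zero]
  exact Finset.sum_congr rfl fun α _ => by ring

variable {γ : Fin N → ℝ} {T : ℝ}

/-- Jump detection with profile `r = a` has `s = ‖a‖²`, which matches the upper bound for the
coefficients of the residual `a`. -/
theorem isOptimalQFI (h : IsBalanced l a p) (ha : IsMinimalResidual l₁ l a) (hpos : 0 < ‖a‖)
    (hγ : ∀ k, 0 < γ k) (hT : 0 < T) :
    IsOptimalQFI l₁ l γ T (ENNReal.ofReal (4 * T * ‖a‖ ^ 2)) := by
  refine HasFastVanishingLimit.of_bounds (by positivity) (fun u hu => ?_) fun u hu => ?_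
  · exact eventually_le_sequentialQFI l₁ l γ h.mem_stdSimplex h.sum_eq_zero h.sum_noise_eq_zero
      (h.sum_signal ha) (by positivity) h.sum_sq hT hu
  · obtain ⟨⟨c₀, c, hc⟩, -⟩ := isMinimalResidual_iff.1 ha
    refine eventually_sequentialQFI_le (c₀ := c₀) (c := c) hγ hT (fun α => ?_) hu
    rw [← hc, ← sq_abs]
    exact pow_le_pow_left₀ (abs_nonneg _) (norm_le_pi_norm a α) 2

theorem isOptimalDistribution (h : IsBalanced l a p) (ha : IsMinimalResidual l₁ l a)
    (hpos : 0 < ‖a‖) (hγ : ∀ k, 0 < γ k) (hT : 0 < T) : IsOptimalDistribution l₁ l γ T p := by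
  refine ⟨h.mem_stdSimplex, _, h.isOptimalQFI ha hpos hγ hT, fun n ψ hψ =>
    HasFastVanishingLimit.of_bounds (by positivity) (fun u hu => ?_) fun u hu => ?_⟩
  · exact eventually_le_measureResetQFI h.sum_eq_zero h.sum_noise_eq_zero
      (h.sum_signal ha) (by positivity) h.sum_sq hT hu hψ
  · obtain ⟨⟨c₀, c, hc⟩, -⟩ := isMinimalResidual_iff.1 ha
    refine eventually_measureResetQFI_le (c₀ := c₀) (c := c) hγ hT h.mem_stdSimplex.2 hψ ?_
    rw [← hc, h.sum_sq]
    exact hu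

end IsBalanced

/-! ### Optimal distributions are balanced. -/

theorem eq_zero_of_quadratic_nonneg {B C : ℝ} (hC : 0 ≤ C)
    (h : ∀ ε : ℝ, 0 ≤ ε ^ 2 * C - 2 * ε * B) : B = 0 := by
  -- Close to the minimiser `B / C`, but meaningful for `C = 0` too.
  have h1 := h (B / (C + 1))
  have h2 : (B / (C + 1)) ^ 2 * C - 2 * (B / (C + 1)) * B = -(B ^ 2 * (C + 2) / (C + 1) ^ 2) := by
    field_simp
    ring
  rw [h2, neg_nonneg] at h1
  by_contra hB
  have : 0 < B ^ 2 * (C + 2) / (C + 1) ^ 2 := by positivity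
  linarith

/-- Testing with `a` itself forces `|a| = ‖a‖` wherever `p` is nonzero. Then `a` minimises the
weighted least-squares problem, and stationarity is the orthogonality of `p a` to `1` and the
noises. -/
theorem isBalanced_of_forall_le (hp : p ∈ stdSimplex ℝ (Fin d)) (ha : IsMinimalResidual l₁ l a)
    (h : ∀ c₀ c, ‖a‖ ^ 2 ≤ ∑ α, p α * noiseResidual l₁ l c₀ c α ^ 2) : IsBalanced l a p := by
  obtain ⟨⟨c₀, c, hc⟩, -⟩ := isMinimalResidual_iff.1 ha
  have hsq : ∀ α, a α ^ 2 ≤ ‖a‖ ^ 2 := fun α => by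
    rw [← sq_abs]
    exact pow_le_pow_left₀ (abs_nonneg _) (norm_le_pi_norm a α) 2
  have h1 : ∀ α, p α * (‖a‖ ^ 2 - a α ^ 2) = 0 := by
    have h2 : ∑ α, p α * (‖a‖ ^ 2 - a α ^ 2) ≤ 0 := by
      have := h c₀ c
      rw [← hc] at this
      simp only [mul_sub, Finset.sum_sub_distrib, ← Finset.sum_mul, hp.2]
      linarith
    have h3 : ∀ α ∈ Finset.univ, 0 ≤ p α * (‖a‖ ^ 2 - a α ^ 2) :=
      fun α _ => mul_nonneg (hp.1 α) (sub_nonneg.2 (hsq α))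
    exact fun α => (Finset.sum_eq_zero_iff_of_nonneg h3).1
      (le_antisymm h2 (Finset.sum_nonneg h3)) α (Finset.mem_univ α)
  have h2 : ∑ α, p α * a α ^ 2 = ‖a‖ ^ 2 := by
    have := Finset.sum_eq_zero fun α (_ : α ∈ Finset.univ) => h1 α
    simp only [mul_sub, Finset.sum_sub_distrib, ← Finset.sum_mul, hp.2] at this
    linarith
  have key : ∀ (e₀ : ℝ) (e : Fin N → ℝ), ∑ α, p α * a α * (e₀ + ∑ k, e k * l k α) = 0 := by
    intro e₀ e
    have hC : 0 ≤ ∑ α, p α * (e₀ + ∑ k, e k * l k α) ^ 2 :=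
      Finset.sum_nonneg fun α _ => mul_nonneg (hp.1 α) (sq_nonneg _)
    refine eq_zero_of_quadratic_nonneg hC fun ε => ?_
    have h4 := h (c₀ + ε * e₀) (c + ε • e)
    have h5 : ∀ α, p α * noiseResidual l₁ l (c₀ + ε * e₀) (c + ε • e) α ^ 2 =
        p α * a α ^ 2 + ε ^ 2 * (p α * (e₀ + ∑ k, e k * l k α) ^ 2)
          - 2 * ε * (p α * a α * (e₀ + ∑ k, e k * l k α)) := by
      intro α
      have h6 : ε * e₀ + ∑ k, (ε • e) k * l k α = ε * (e₀ + ∑ k, e k * l k α) := by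
        simp [mul_add, Finset.mul_sum, mul_assoc]
      rw [noiseResidual_sub, ← hc, h6]
      ring
    rw [Finset.sum_congr rfl fun α _ => h5 α, Finset.sum_sub_distrib, Finset.sum_add_distrib,
      ← Finset.mul_sum, ← Finset.mul_sum, h2] at h4
    linarith
  refine ⟨hp, fun α hα => ?_, ?_, fun k => ?_⟩
  · refine Finset.mem_filter.2 ⟨Finset.mem_univ _, ?_⟩
    have h3 : ‖a‖ ^ 2 = a α ^ 2 := by
      have := (mul_eq_zero.1 (h1 α)).resolve_left hα
      linarith
    rw [← Real.sqrt_sq_eq_abs, ← h3, Real.sqrt_sq (norm_nonneg _)]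
  · simpa using key 1 0
  · simpa [Pi.single_apply] using key 0 (Pi.single k 1)

/-- If some residual had a `p`-average of squares below `‖a‖²`, measure-and-reset with amplitudes
`√p` would fall strictly short of the optimum. -/
theorem isOptimalDistribution_iff {γ : Fin N → ℝ} {T : ℝ} (ha : IsMinimalResidual l₁ l a)
    (hpos : 0 < ‖a‖) (hγ : ∀ k, 0 < γ k) (hT : 0 < T) :
    IsOptimalDistribution l₁ l γ T p ↔ IsBalanced l a p := by
  refine ⟨fun h => ?_, fun h => h.isOptimalDistribution ha hpos hγ hT⟩
  obtain ⟨hp, v, hv, hψ⟩ := h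
  obtain ⟨p', hp'⟩ := exists_isBalanced ha hpos
  have hv' := hasFastVanishingLimit_unique hv (hp'.isOptimalQFI ha hpos hγ hT)
  refine isBalanced_of_forall_le hp ha fun c₀ c => ?_
  by_contra! hlt
  obtain ⟨ψ, hpop⟩ : ∃ ψ : Fin d × Fin 1 → ℂ, ∀ α, ∑ β, ‖ψ (α, β)‖ ^ 2 = p α :=
    ⟨fun x => (√(p x.1) : ℂ), fun α => by simp [Real.sq_sqrt (hp.1 α)]⟩
  obtain ⟨u, hu1, hu2⟩ := exists_between (mul_lt_mul_of_pos_left hlt (show 0 < 4 * T by positivity))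
  have h1 := (hψ 1 ψ hpop).le_of_eventually_le
    (eventually_measureResetQFI_le (c₀ := c₀) (c := c) hγ hT hp.2 hpop hu1)
  rw [hv'] at h1
  refine absurd h1 (not_le.2 ?_)
  rw [ENNReal.ofReal_lt_ofReal_iff (by positivity)]
  exact hu2

end Residual

/-! ## Distributions determined by one-dimensional orthogonal complements -/

/-- `|w| = |κ| A p`, so normalising recovers `p`; also `∑ w² = κ A²` and `∑ |w| = |κ| A`, so `κ`
cancels in the ratio. -/
theorem distribution_of_proportional {ι : Type} [Fintype ι] {w p a : ι → ℝ} {A κ : ℝ} (hA : 0 < A)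
    (hp : ∀ i, 0 ≤ p i) (hp1 : ∑ i, p i = 1) (hpa : ∀ i, p i * |a i| = p i * A)
    (hw : ∀ i, w i = κ * (p i * a i)) (hwA : ∑ i, w i * (p i * a i) = A ^ 2) :
    (∀ i, |w i| / ∑ j, |w j| = p i) ∧ (∑ i, w i ^ 2) ^ 2 / (∑ i, |w i|) ^ 2 = A ^ 2 := by
  have h1 : ∀ i, |w i| = |κ| * A * p i := fun i => by
    rw [hw, abs_mul, abs_mul, abs_of_nonneg (hp i), hpa]
    ring
  have h2 : ∑ i, |w i| = |κ| * A := by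
    simp only [h1, ← Finset.mul_sum, hp1, mul_one]
  have h3 : ∑ i, w i ^ 2 = κ * A ^ 2 := by
    rw [← hwA, Finset.mul_sum]
    refine Finset.sum_congr rfl fun i _ => ?_
    rw [sq]
    nth_rewrite 2 [hw]
    ring
  have hκ : κ ≠ 0 := by
    rintro rfl
    simp only [hw, zero_mul, Finset.sum_const_zero] at hwA
    exact absurd hwA.symm (by positivity)
  have hκ' : |κ| ≠ 0 := abs_ne_zero.2 hκ
  refine ⟨fun i => ?_, ?_⟩
  · rw [h1, h2]
    field_simp
  · rw [h2, h3, mul_pow, mul_pow, sq_abs]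
    field_simp

section NoiseSpan

variable {d N : ℕ} {l₁ : Fin d → ℝ} {l : Fin N → Fin d → ℝ} {a p : Fin d → ℝ}

theorem mem_noiseSpan_orthogonal_iff {I : Finset (Fin d)} {x : EuclideanSpace ℝ I} :
    x ∈ (noiseSpan l I)ᗮ ↔ ∑ α, x α = 0 ∧ ∀ k, ∑ α, x α * l k α = 0 := by
  rw [noiseSpan, Submodule.mem_orthogonal]
  constructor
  · intro h
    refine ⟨?_, fun k => ?_⟩
    · have := h _ (Submodule.subset_span (Set.mem_insert _ _))
      simpa [PiLp.inner_apply] using this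
    · have := h _ (Submodule.subset_span (Set.mem_insert_of_mem _ ⟨k, rfl⟩))
      simpa [PiLp.inner_apply] using this
  · rintro ⟨h1, h2⟩ u hu
    induction hu using Submodule.span_induction with
    | mem u hu =>
      rcases hu with rfl | ⟨k, rfl⟩
      · simpa [PiLp.inner_apply] using h1
      · simpa [PiLp.inner_apply] using h2 k
    | zero => simp
    | add u v _ _ hu hv => rw [inner_add_left, hu, hv, add_zero]
    | smul c u _ hu => rw [inner_smul_left, hu, mul_zero]

theorem sum_coe_of_support {I : Finset (Fin d)} (hI : ∀ α, p α ≠ 0 → α ∈ I) (g : Fin d → ℝ) :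
    ∑ α : I, p α * g α = ∑ α, p α * g α := by
  rw [Finset.sum_coe_sort I fun α => p α * g α]
  refine Finset.sum_subset (Finset.subset_univ _) fun α _ hα => ?_
  rw [not_not.1 (mt (hI α) hα), zero_mul]

theorem finrank_noiseSpan_orthogonal (I : Finset (Fin d)) :
    Module.finrank ℝ (noiseSpan l I) + Module.finrank ℝ (noiseSpan l I)ᗮ = I.card := by
  rw [Submodule.finrank_add_finrank_orthogonal, finrank_euclideanSpace, Fintype.card_coe]

namespace IsBalanced

theorem mem_orthogonal (h : IsBalanced l a p) {I : Finset (Fin d)} (hI : ∀ α, p α ≠ 0 → α ∈ I) :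
    WithLp.toLp 2 (fun α : I => p α * a α) ∈ (noiseSpan l I)ᗮ := by
  rw [mem_noiseSpan_orthogonal_iff]
  refine ⟨(sum_coe_of_support hI a).trans h.sum_eq_zero, fun k => ?_⟩
  have := sum_coe_of_support hI fun α => a α * l k α
  simp only [← mul_assoc] at this
  exact this.trans (h.sum_noise_eq_zero k)

/-- The orthogonal complement of the noise span is a line containing `p a`. Its inner product with
the perpendicular part of `l₁` is `‖a‖² ≠ 0`, so `p a` spans that line. The support of `p` need only
lie inside `I`. -/
theorem eq_absDistribution (h : IsBalanced l a p) (ha : IsMinimalResidual l₁ l a) (hpos : 0 < ‖a‖)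
    {I : Finset (Fin d)} (hI : ∀ α, p α ≠ 0 → α ∈ I)
    (hdim : Module.finrank ℝ (noiseSpan l I) + 1 = I.card) (T : ℝ) :
    p = absDistribution I (perpPart l₁ l I) ∧
      normRatioQFI T (perpPart l₁ l I) = ENNReal.ofReal (4 * T * ‖a‖ ^ 2) := by
  set x : EuclideanSpace ℝ I := WithLp.toLp 2 fun α : I => p α * a α with hx
  have hxmem : x ∈ (noiseSpan l I)ᗮ := h.mem_orthogonal hI
  have hfin : Module.finrank ℝ (noiseSpan l I)ᗮ = 1 := by
    have := finrank_noiseSpan_orthogonal (l := l) I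
    omega
  have hwx : inner ℝ (perpPart l₁ l I) x = ‖a‖ ^ 2 := by
    rw [perpPart, Submodule.inner_starProjection_left_eq_right,
      Submodule.starProjection_eq_self_iff.2 hxmem, ← h.sum_signal ha]
    have := sum_coe_of_support hI fun α => a α * l₁ α
    simp only [← mul_assoc] at this
    rw [← this]
    simp [PiLp.inner_apply, hx]
  have hx0 : x ≠ 0 := by
    intro h0
    rw [h0, inner_zero_right] at hwx
    exact absurd hwx.symm (by positivity)
  obtain ⟨κ, hκ⟩ := (finrank_eq_one_iff_of_nonzero' (⟨x, hxmem⟩ : (noiseSpan l I)ᗮ)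
    (by simpa using hx0)).1 hfin ⟨perpPart l₁ l I, Submodule.starProjection_apply_mem _ _⟩
  have hκ' : κ • x = perpPart l₁ l I := congrArg Subtype.val hκ
  have hsum1 : ∑ α : I, p α = 1 := by
    have := sum_coe_of_support hI fun _ => 1
    simpa [h.mem_stdSimplex.2] using this
  obtain ⟨h1, h2⟩ := distribution_of_proportional (w := perpPart l₁ l I) (p := fun α : I => p α)
    (a := fun α : I => a α) (κ := κ) hpos (fun α => h.mem_stdSimplex.1 α) hsum1
    (fun α => h.mul_abs_eq α) (fun α => by rw [← hκ']; rfl)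
    (by rw [← hwx]; simp [PiLp.inner_apply, hx, mul_comm])
  refine ⟨funext fun α => ?_, ?_⟩
  · by_cases hα : α ∈ I
    · rw [absDistribution, dif_pos hα, h1 ⟨α, hα⟩]
    · rw [absDistribution, dif_neg hα, not_not.1 (mt (hI α) hα)]
  · rw [normRatioQFI, mul_div_assoc, h2]

/-- A balanced distribution with minimal support. -/
theorem finrank_of_minimal (h : IsBalanced l a p) (hpos : 0 < ‖a‖) {I : Finset (Fin d)}
    (hI : ∀ α, α ∈ I ↔ p α ≠ 0)
    (hmin : ∀ p', IsBalanced l a p' → (∀ α, p' α ≠ 0 → α ∈ I) → ∀ α ∈ I, p' α ≠ 0) :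
    Module.finrank ℝ (noiseSpan l I) + 1 = I.card := by
  rw [← finrank_noiseSpan_orthogonal (l := l) I]
  congr 1
  symm
  have ha0 : ∀ α ∈ I, a α ≠ 0 := fun α hα h0 => by
    have h1 := (Finset.mem_filter.1 (h.support α ((hI α).1 hα))).2
    rw [h0, abs_zero] at h1
    exact hpos.ne h1
  have hp0 : ∀ α ∈ I, 0 < p α := fun α hα =>
    lt_of_le_of_ne (h.mem_stdSimplex.1 α) ((hI α).1 hα).symm
  have hne : I.Nonempty := by
    by_contra! h0
    have h1 : ∀ α, p α = 0 := fun α => not_not.1 fun hα => by simpa [h0] using (hI α).2 hα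
    simpa [h1] using h.mem_stdSimplex.2
  have hx := h.mem_orthogonal fun α => (hI α).2
  refine finrank_eq_one (⟨_, hx⟩ : (noiseSpan l I)ᗮ) ?_ fun u => ?_
  · intro h0
    obtain ⟨α, hα⟩ := hne
    have h1 := congrFun (congrArg (fun z => WithLp.ofLp (Subtype.val z)) h0) ⟨α, hα⟩
    simp only [Submodule.coe_zero, PiLp.zero_apply] at h1
    exact (mul_ne_zero (hp0 α hα).ne' (ha0 α hα)) h1
  -- Given `u` in the complement, `p' = c p - u / a` on `I` with the least `c` that keeps it
  -- nonnegative; it vanishes at the index `α₀` where `w / p` is largest.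
  · set w : Fin d → ℝ := fun α => if hα : α ∈ I then u.1 ⟨α, hα⟩ / a α else 0 with hw
    obtain ⟨α₀, hα₀, hmax⟩ := I.exists_max_image (fun α => w α / p α) hne
    set c := w α₀ / p α₀ with hc
    have hwa : ∀ α : I, w α * a α = u.1 α := fun α => by
      simp only [hw, α.2, dif_pos]
      rw [div_mul_cancel₀ _ (ha0 α α.2)]
    set p' : Fin d → ℝ := fun α => c * p α - w α with hp'
    have hp'I : ∀ α, p' α ≠ 0 → α ∈ I := by
      intro α hα
      by_contra hαI
      refine hα ?_
      simp only [hp', hw, hαI, dif_neg, not_false_eq_true]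
      rw [not_not.1 (mt (hI α).2 hαI)]
      simp
    have hp'0 : ∀ α, 0 ≤ p' α := by
      intro α
      by_cases hα : α ∈ I
      · have := (div_le_iff₀ (hp0 α hα)).1 (hmax α hα)
        simp only [hp']
        linarith
      · rw [not_not.1 (mt (hp'I α) hα)]
    have hu := mem_noiseSpan_orthogonal_iff.1 u.2
    have hx' := mem_noiseSpan_orthogonal_iff.1 hx
    have hz : p' α₀ = 0 := by
      simp only [hp', hc]
      rw [div_mul_cancel₀ _ (hp0 α₀ hα₀).ne', sub_self]
    have hp'a : ∀ α : I, p' α * a α = c * (p α * a α) - u.1 α := fun α => by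
      rw [← hwa]
      ring
    have hA : ∑ α, p' α * a α = 0 := by
      rw [← sum_coe_of_support hp'I a]
      simp only [hp'a, Finset.sum_sub_distrib, ← Finset.mul_sum]
      rw [hu.1, hx'.1]
      simp
    have hB : ∀ k, ∑ α, p' α * (a α * l k α) = 0 := by
      intro k
      rw [← sum_coe_of_support hp'I fun α => a α * l k α]
      simp only [← mul_assoc, hp'a, sub_mul, Finset.sum_sub_distrib]
      simp only [mul_assoc c, ← Finset.mul_sum]
      rw [hu.2, hx'.2]
      simp
    -- Otherwise `p'`, normalised, would be balanced with a support inside `I` that omits `α₀`,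
    -- against minimality. Hence `p' = 0`, and `u` is `c` times `p a`.
    have hs : ∑ α, p' α = 0 := by
      by_contra hs
      have hs' : 0 < ∑ α, p' α := lt_of_le_of_ne (Finset.sum_nonneg fun α _ => hp'0 α) (Ne.symm hs)
      refine hmin (fun α => (∑ α, p' α)⁻¹ * p' α) ⟨⟨fun α => ?_, ?_⟩, fun α hα => ?_, ?_, fun k => ?_⟩
        (fun α hα => hp'I α (right_ne_zero_of_mul hα)) α₀ hα₀ (by rw [hz, mul_zero])
      · exact mul_nonneg (inv_nonneg.2 hs'.le) (hp'0 α)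
      · rw [← Finset.mul_sum, inv_mul_cancel₀ hs]
      · exact h.support α ((hI α).1 (hp'I α (right_ne_zero_of_mul hα)))
      · simp only [mul_assoc, ← Finset.mul_sum]
        rw [hA, mul_zero]
      · simp only [mul_assoc, ← Finset.mul_sum]
        rw [hB, mul_zero]
    refine ⟨c, Subtype.ext ?_⟩
    ext α
    have h1 := (Finset.sum_eq_zero_iff_of_nonneg fun α _ => hp'0 α).1 hs α (Finset.mem_univ _)
    have h2 := hp'a α
    rw [h1, zero_mul] at h2
    exact (sub_eq_zero.1 h2.symm)

end IsBalanced

/-! ### The full index set and the qubit. -/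

theorem finrank_noiseSpan_univ (hd : 0 < d) (hl : ∀ k, l k ≠ 0) (hsum : ∀ k, ∑ α, l k α = 0)
    (horth : ∀ j k, j ≠ k → ∑ α, l j α * l k α = 0) :
    Module.finrank ℝ (noiseSpan l Finset.univ) = N + 1 := by
  set v : Option (Fin N) → EuclideanSpace ℝ (Finset.univ : Finset (Fin d)) :=
    fun o => o.elim (WithLp.toLp 2 fun _ => 1) fun k => WithLp.toLp 2 fun α => l k α with hv
  have hS : ∀ g : Fin d → ℝ, ∑ α : (Finset.univ : Finset (Fin d)), g α = ∑ α, g α := fun g =>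
    Finset.sum_coe_sort Finset.univ g
  have hspan : noiseSpan l Finset.univ = Submodule.span ℝ (Set.range v) := by
    rw [noiseSpan]
    congr 1
    ext x
    simp [hv, Option.exists, eq_comm]
  have hlin : LinearIndependent ℝ v := by
    refine linearIndependent_of_ne_zero_of_inner_eq_zero (fun o h0 => ?_) fun o o' ho => ?_
    · cases o with
      | none =>
        have := congrFun (congrArg WithLp.ofLp h0) ⟨⟨0, hd⟩, Finset.mem_univ _⟩
        simp [hv] at this
      | some k =>
        refine hl k (funext fun α => ?_)
        exact congrFun (congrArg WithLp.ofLp h0) ⟨α, Finset.mem_univ _⟩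
    · cases o with
      | none =>
        cases o' with
        | none => exact absurd rfl ho
        | some k => simpa [hv, PiLp.inner_apply] using (hS (l k)).trans (hsum k)
      | some j =>
        cases o' with
        | none => simpa [hv, PiLp.inner_apply] using (hS (l j)).trans (hsum j)
        | some k =>
          have h1 := (hS fun α => l k α * l j α).trans (horth k j (by rintro rfl; exact ho rfl))
          simpa [hv, PiLp.inner_apply] using h1
  rw [hspan, finrank_span_eq_card hlin]
  simp

theorem perpPart_univ (hsum₁ : ∑ α, l₁ α = 0) (horth₁ : ∀ k, ∑ α, l₁ α * l k α = 0)
    (α : (Finset.univ : Finset (Fin d))) : perpPart l₁ l Finset.univ α = l₁ α := by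
  have h : WithLp.toLp 2 (fun α : (Finset.univ : Finset (Fin d)) => l₁ α) ∈
      (noiseSpan l Finset.univ)ᗮ := by
    rw [mem_noiseSpan_orthogonal_iff]
    exact ⟨(Finset.sum_coe_sort Finset.univ l₁).trans hsum₁, fun k =>
      (Finset.sum_coe_sort Finset.univ fun α => l₁ α * l k α).trans (horth₁ k)⟩
  rw [perpPart, Submodule.starProjection_eq_self_iff.2 h]

theorem absDistribution_univ (hsum₁ : ∑ α, l₁ α = 0) (horth₁ : ∀ k, ∑ α, l₁ α * l k α = 0) :
    absDistribution Finset.univ (perpPart l₁ l Finset.univ) = fun α => |l₁ α| / ∑ β, |l₁ β| := by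
  ext α
  rw [absDistribution, dif_pos (Finset.mem_univ α)]
  simp only [perpPart_univ hsum₁ horth₁]
  rw [Finset.sum_coe_sort Finset.univ fun β => |l₁ β|]

theorem normRatioQFI_univ (hsum₁ : ∑ α, l₁ α = 0) (horth₁ : ∀ k, ∑ α, l₁ α * l k α = 0) (T : ℝ) :
    normRatioQFI T (perpPart l₁ l Finset.univ) = normRatioQFI T l₁ := by
  rw [normRatioQFI, normRatioQFI]
  simp only [perpPart_univ hsum₁ horth₁]
  rw [Finset.sum_coe_sort Finset.univ fun β => |l₁ β|,
    Finset.sum_coe_sort Finset.univ fun β => l₁ β ^ 2]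

theorem normRatioQFI_qubit {l₁ : Fin 2 → ℝ} (hl₁ : l₁ ≠ 0) (hsum₁ : ∑ α, l₁ α = 0) (T : ℝ) :
    normRatioQFI T l₁ = ENNReal.ofReal (2 * T * ∑ α, l₁ α ^ 2) := by
  rw [Fin.sum_univ_two] at hsum₁
  have h1 : l₁ 1 = -l₁ 0 := by linarith
  have h0 : |l₁ 0| ≠ 0 := by
    refine abs_ne_zero.2 fun h0 => hl₁ (funext fun α => ?_)
    fin_cases α
    · exact h0
    · simpa [h0] using h1
  rw [normRatioQFI]
  simp only [Fin.sum_univ_two, h1, abs_neg, neg_sq, ← sq_abs (l₁ 0)]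
  congr 1
  field_simp
  ring

end NoiseSpan

/-! ### Assembly of the claims. -/

theorem mainTheorem8 {d N : ℕ} (l₁ : Fin d → ℝ) (l : Fin N → Fin d → ℝ) (γ : Fin N → ℝ) (T : ℝ)
    (hT : 0 < T) (hγ : ∀ k, 0 < γ k)
    (hl₁ : l₁ ≠ 0) (hl : ∀ k, l k ≠ 0)
    (hsum₁ : ∑ α, l₁ α = 0) (hsum : ∀ k, ∑ α, l k α = 0)
    (horth₁ : ∀ k, ∑ α, l₁ α * l k α = 0)
    (horth : ∀ j k, j ≠ k → ∑ α, l j α * l k α = 0) :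
    -- one signal and `d - 2` noises
    (d = N + 2 → (IsRegularNoise l ∨ d = 3) →
      IsOptimalQFI l₁ l γ T (normRatioQFI T l₁) ∧
      ∀ p : Fin d → ℝ,
        IsOptimalDistribution l₁ l γ T p ↔ p = fun α => |l₁ α| / ∑ β, |l₁ β|) ∧
    -- the noiseless case in two dimensions
    (N = 0 → d = 2 → IsOptimalQFI l₁ l γ T (ENNReal.ofReal (2 * T * ∑ α, l₁ α ^ 2))) ∧
    -- any dimension and any number of noises
    (∃ p, IsOptimalDistribution l₁ l γ T p) ∧
    (∀ a : Fin d → ℝ, IsMinimalResidual l₁ l a →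
      IsOptimalQFI l₁ l γ T (ENNReal.ofReal (4 * T * ‖a‖ ^ 2)) ∧
      (∀ p, IsOptimalDistribution l₁ l γ T p → ∀ α, p α ≠ 0 → α ∈ maxIndices a) ∧
      (Module.finrank ℝ (noiseSpan l (maxIndices a)) + 1 = (maxIndices a).card →
        IsOptimalQFI l₁ l γ T (normRatioQFI T (perpPart l₁ l (maxIndices a))) ∧
        ∀ p : Fin d → ℝ, IsOptimalDistribution l₁ l γ T p ↔
          p = absDistribution (maxIndices a) (perpPart l₁ l (maxIndices a)))) ∧
    (∀ I : Finset (Fin d), Minimal (IsOptimalSupport l₁ l γ T) I →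
      IsOptimalQFI l₁ l γ T (normRatioQFI T (perpPart l₁ l I)) ∧
      ∀ p : Fin d → ℝ, IsOptimalDistribution l₁ l γ T p ∧ (∀ α, α ∈ I ↔ p α ≠ 0) ↔
        p = absDistribution I (perpPart l₁ l I)) := by
  obtain ⟨a, ha⟩ := exists_isMinimalResidual l₁ l
  have hpos : ∀ {a}, IsMinimalResidual l₁ l a → 0 < ‖a‖ := fun ha => ha.norm_pos hl₁ hsum₁ horth₁
  obtain ⟨p₀, hp₀⟩ := exists_isBalanced ha (hpos ha)
  have hopt : ∀ {a p}, IsMinimalResidual l₁ l a →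
      (IsOptimalDistribution l₁ l γ T p ↔ IsBalanced l a p) :=
    fun ha => isOptimalDistribution_iff ha (hpos ha) hγ hT
  -- On all `d = N + 2` indices the noise span has codimension one by orthogonality, and `l₁` is its
  -- own perpendicular part, so `eq_absDistribution` applies with the full index set.
  have hone : d = N + 2 → IsOptimalQFI l₁ l γ T (normRatioQFI T l₁) ∧
      ∀ p : Fin d → ℝ,
        IsOptimalDistribution l₁ l γ T p ↔ p = fun α => |l₁ α| / ∑ β, |l₁ β| := by
    intro hd
    have hdim : Module.finrank ℝ (noiseSpan l Finset.univ) + 1 =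
        (Finset.univ : Finset (Fin d)).card := by
      rw [finrank_noiseSpan_univ (by omega) hl hsum horth, Finset.card_univ, Fintype.card_fin, hd]
    have key : ∀ p, IsBalanced l a p → p = (fun α => |l₁ α| / ∑ β, |l₁ β|) ∧
        normRatioQFI T l₁ = ENNReal.ofReal (4 * T * ‖a‖ ^ 2) := by
      intro p hp
      rw [← absDistribution_univ hsum₁ horth₁, ← normRatioQFI_univ hsum₁ horth₁]
      exact hp.eq_absDistribution ha (hpos ha) (fun α _ => Finset.mem_univ α) hdim T
    refine ⟨?_, fun p => ⟨fun h => (key p ((hopt ha).1 h)).1, ?_⟩⟩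
    · rw [(key p₀ hp₀).2]
      exact hp₀.isOptimalQFI ha (hpos ha) hγ hT
    · rintro rfl
      rw [← (key p₀ hp₀).1]
      exact (hopt ha).2 hp₀
  refine ⟨fun hd _ => hone hd, fun hN hd => ?_, ⟨p₀, (hopt ha).2 hp₀⟩, fun b hb => ?_,
    fun I hI => ?_⟩
  · subst hN hd
    rw [← normRatioQFI_qubit hl₁ hsum₁]
    exact (hone rfl).1
  · obtain ⟨p₁, hp₁⟩ := exists_isBalanced hb (hpos hb)
    have hQ := hp₁.isOptimalQFI hb (hpos hb) hγ hT
    refine ⟨hQ, fun p hp => ((hopt hb).1 hp).support, fun hdim => ⟨?_, fun p => ⟨fun hp => ?_, ?_⟩⟩⟩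
    · rwa [(hp₁.eq_absDistribution hb (hpos hb) hp₁.support hdim T).2]
    · have hp' := (hopt hb).1 hp
      exact (hp'.eq_absDistribution hb (hpos hb) hp'.support hdim T).1
    · rintro rfl
      rw [← (hp₁.eq_absDistribution hb (hpos hb) hp₁.support hdim T).1]
      exact (hopt hb).2 hp₁
  · obtain ⟨⟨p, hp, hpI⟩, hmin⟩ := hI
    have hp' := (hopt ha).1 hp
    -- The support of a balanced `q` supported inside `I` is itself an optimal support, so
    -- minimality makes it all of `I`.
    have hdim := hp'.finrank_of_minimal (hpos ha) hpI fun q hq hqI α hα =>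
      (Finset.mem_filter.1 (hmin (y := Finset.univ.filter fun α => q α ≠ 0)
        ⟨q, (hopt ha).2 hq, by simp⟩ (fun β hβ => hqI β (Finset.mem_filter.1 hβ).2) hα)).2
    have key := hp'.eq_absDistribution ha (hpos ha) (fun α => (hpI α).2) hdim T
    refine ⟨?_, fun q => ⟨fun hq => ?_, ?_⟩⟩
    · rw [key.2]
      exact hp'.isOptimalQFI ha (hpos ha) hγ hT
    · exact (((hopt ha).1 hq.1).eq_absDistribution ha (hpos ha) (fun α => (hq.2 α).2) hdim T).1
    · rintro rfl
      rw [← key.1]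
      exact ⟨hp, hpI⟩
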